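/- Fix integers $\kappa, m, r \ge 0$, a finite set $\Omega$ of attacker types, and $\Omega^o := \Omega\cup\{\omega_o\}$ with $\omega_o\notin\Omega$ ($\omega_o$ is the controller of the system). Let $A\in\mathbb{R}^{m\times m}$, $B\in\mathbb{R}^{m\times r}$, let $\Sigma_1,\Sigma_w\in\mathbb{R}^{m\times m}$ be symmetric positive semi-definite, and for every $\omega\in\Omega^o$ let $Q^\omega\in\mathbb{R}^{m\times m}$ be symmetric positive semi-definite and $R^\omega\in\mathbb{R}^{r\times r}$ symmetric positive definite. Write $\|x\|_Q^2 := x'Qx$. A signaling rule $\eta\in\Upsilon$ consists of matrices $L_{k,j}\in\mathbb{R}^{m\times m}$ ($1\le j\le k\le\kappa$) and symmetric positive semi-definite matrices $\Theta_k\in\mathbb{R}^{m\times m}$ ($1\le k\le\kappa$). A control policy $\gamma\in\Gamma$ consists of Borel measurable maps $\gamma_k:(\mathbb{R}^{m})^k\to\mathbb{R}^r$ ($1\le k\le\kappa$). Given $\eta$ and $\gamma$, let $\boldsymbol{x}_1\sim\mathcal N(0,\Sigma_1)$, $\boldsymbol{w}_k\sim\mathcal N(0,\Sigma_w)$ and $\boldsymbol{\vartheta}_k\sim\mathcal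 N(0,\Theta_k)$ ($1\le k\le\kappa$) be independent (possibly degenerate) Gaussian vectors and let, for $k=1,\dots,\kappa$ (perfect measurements), $$\boldsymbol{s}_k=\sum_{j=1}^k L_{k,j}'\boldsymbol{x}_j+\boldsymbol{\vartheta}_k,\qquad \boldsymbol{u}_k=\gamma_k(\boldsymbol{s}_1,\dots,\boldsymbol{s}_k),\qquad \boldsymbol{x}_{k+1}=A\boldsymbol{x}_k+B\boldsymbol{u}_k+\boldsymbol{w}_k .$$ When type $\omega$ of the follower uses a policy $\gamma^\omega$, denote the resulting states and inputs by $\boldsymbol{x}_k^\omega,\boldsymbol{u}_k^\omega$. The cost of the type-$\omega$ follower is $$U_C^\omega(\eta,\gamma^\omega)=\sum_{k=1}^\kappa\Big(\mathbb{E}\|\boldsymbol{x}^\omega_{k+1}\|^2_{Q^\omega}+\mathbb{E}\|\boldsymbol{u}^\omega_k\|^2_{R^\omega}\Big)\in[0,\infty],$$ and the cost of the leader (the sensor) is $$U_S(\eta,\{\gamma^\omega\}_{\omega\in\Omega^o})=\max_{p\in\Delta(\Omega^o)}\Big\{\sum_{\omega\in\Omega}p_\omega\sum_{k=1}^\kappa\mathbb{E}\|\boldsymbol{x}^\omega_{k+1}\|^2_{Q^{\omega_o}}+p_{\omega_o}\sum_{k=1}^\kappa\Big(\mathbb{E}\|\boldsymbol{x}^{\omega_o}_{k+1}\|^2_{Q^{\omega_o}}+\mathbb{E}\|\boldsymbol{u}^{\omega_o}_k\|^2_{R^{\omega_o}}\Big)\Big\},$$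 where $\Delta(\Omega^o)$ is the set of probability distributions on $\Omega^o$ and $0\cdot\infty=0$. Then the leader's cost does not depend on the choice of the best responses: for every $\eta\in\Upsilon$, if $\gamma^\omega$ and $\tilde\gamma^\omega$ both minimize $U_C^\omega(\eta,\cdot)$ over $\Gamma$ for every $\omega\in\Omega^o$, then $U_S(\eta,\{\gamma^\omega\}_{\omega\in\Omega^o})=U_S(\eta,\{\tilde\gamma^\omega\}_{\omega\in\Omega^o})$. Moreover, the Stackelberg game has at least one equilibrium: there exist $\eta\in\Upsilon$ and reaction maps $\eta'\mapsto\gamma^\omega(\eta')\in\Gamma$ ($\omega\in\Omega^o$) such that $$\gamma^\omega(\eta')\in\operatorname*{arg\,min}_{\gamma\in\Gamma}U_C^\omega(\eta',\gamma)\quad\text{for all }\eta'\in\Upsilon,\ \omega\in\Omega^o,\qquad\text{and}\qquad \eta\in\operatorname*{arg\,min}_{\eta'\in\Upsilon}U_S\big(\eta',\{\gamma^\omega(\eta')\}_{\omega\in\Omega^o}\big).$$ -/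

import Mathlib

open MeasureTheory ProbabilityTheory
open scoped Matrix ENNReal

noncomputable section

namespace SensorDesign

/-- Vectors in `ℝ^d`. -/
abbrev Vec (d : ℕ) : Type := EuclideanSpace ℝ (Fin d)

/-- The squared weighted seminorm `‖x‖_Q² = x' Q x`. -/
def wsq {d : ℕ} (Q : Matrix (Fin d) (Fin d) ℝ) (x : Vec d) : ℝ :=
  x.ofLp ⬝ᵥ (Q *ᵥ x.ofLp)

/-- A linear-plus-noise signaling rule over the horizon `κ`, with perfect measurements.
Stages are numbered `0, …, κ - 1`. At stage `k` the signal is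
`s k = ∑ j ≤ k, (gain k j)' * x j + θ k` with `θ k ∼ N(0, noiseCov k)`. -/
structure SignalingRule (κ m : ℕ) where
  gain : (k : Fin κ) → Fin (k.val + 1) → Matrix (Fin m) (Fin m) ℝ
  noiseCov : Fin κ → Matrix (Fin m) (Fin m) ℝ
  noiseCov_posSemidef : ∀ k, (noiseCov k).PosSemidef

/-- A control policy: at stage `k` a Borel measurable function of the signals `s 0, …, s k`. -/
structure ControlPolicy (κ m r : ℕ) where
  act : (k : Fin κ) → (Fin (k.val + 1) → Vec m) → Vec r
  measurable_act : ∀ k, Measurable (act k)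

/-- The data of the game. The types of the follower are `Option Ω`: `some ω` is the type-`ω`
attacker and `none` is the controller of the system. -/
structure Game (κ m r : ℕ) (Ω : Type*) where
  A : Matrix (Fin m) (Fin m) ℝ
  B : Matrix (Fin m) (Fin r) ℝ
  covInit : Matrix (Fin m) (Fin m) ℝ
  covNoise : Matrix (Fin m) (Fin m) ℝ
  Q : Option Ω → Matrix (Fin m) (Fin m) ℝ
  R : Option Ω → Matrix (Fin r) (Fin r) ℝ

/-- Realizations of the primitive random variables: the initial state, the state noises, and the
noises added to the signals. -/
abbrev Sample (κ m : ℕ) : Type := Vec m × (Fin κ → Vec m) × (Fin κ → Vec m)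

variable {κ m r : ℕ} {Ω : Type*}

namespace Game

/-- The law of the primitive random variables under the signaling rule `η`: they are independent,
centered and Gaussian, with covariances `covInit`, `covNoise` and `η.noiseCov k`. -/
def law (G : Game κ m r Ω) (η : SignalingRule κ m) : Measure (Sample κ m) :=
  (multivariateGaussian 0 G.covInit).prod
    ((Measure.pi fun _ : Fin κ => multivariateGaussian 0 G.covNoise).prod
      (Measure.pi fun k : Fin κ => multivariateGaussian 0 (η.noiseCov k)))

/-- The closed-loop state after `n` stages. With `u n = γ n (s 0, …, s n)`, where
`s j = ∑ i ≤ j, (gain j i)' * x i + θ j`, it satisfies `x (n + 1) = A x n + B u n + w n`. -/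
def state (G : Game κ m r Ω) (η : SignalingRule κ m) (γ : ControlPolicy κ m r)
    (z : Sample κ m) : (n : ℕ) → n ≤ κ → Vec m
  | 0, _ => z.1
  | n + 1, h =>
    Matrix.toEuclideanLin G.A (state G η γ z n (by omega))
      + Matrix.toEuclideanLin G.B (γ.act ⟨n, h⟩ fun j : Fin (n + 1) =>
          (∑ i : Fin (j.val + 1),
            Matrix.toEuclideanLin (η.gain ⟨j.val, by omega⟩ i)ᵀ
              (state G η γ z i.val (by omega)))
            + z.2.2 ⟨j.val, by omega⟩)
      + z.2.1 ⟨n, h⟩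
termination_by n => n
decreasing_by all_goals omega

/-- The signal sent at stage `k`. -/
def signal (G : Game κ m r Ω) (η : SignalingRule κ m) (γ : ControlPolicy κ m r)
    (z : Sample κ m) (k : Fin κ) : Vec m :=
  (∑ i : Fin (k.val + 1),
    Matrix.toEuclideanLin (η.gain k i)ᵀ (G.state η γ z i.val (by omega))) + z.2.2 k

/-- The control input at stage `k`, a function of the signals up to stage `k`. -/
def control (G : Game κ m r Ω) (η : SignalingRule κ m) (γ : ControlPolicy κ m r)
    (z : Sample κ m) (k : Fin κ) : Vec r :=
  γ.act k fun j : Fin (k.val + 1) => G.signal η γ z ⟨j.val, by omega⟩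

theorem state_zero (G : Game κ m r Ω) (η : SignalingRule κ m) (γ : ControlPolicy κ m r)
    (z : Sample κ m) (h : 0 ≤ κ) : G.state η γ z 0 h = z.1 := by
  rw [state]

/-- The closed-loop dynamics. -/
theorem state_succ (G : Game κ m r Ω) (η : SignalingRule κ m) (γ : ControlPolicy κ m r)
    (z : Sample κ m) (k : Fin κ) :
    G.state η γ z (k.val + 1) k.isLt =
      Matrix.toEuclideanLin G.A (G.state η γ z k.val k.isLt.le)
        + Matrix.toEuclideanLin G.B (G.control η γ z k) + z.2.1 k := by
  rw [state]
  rfl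

/-- `∑ k, E ‖x (k + 1)‖_W²`, an element of `[0, ∞]`. -/
def stateCost (G : Game κ m r Ω) (W : Matrix (Fin m) (Fin m) ℝ) (η : SignalingRule κ m)
    (γ : ControlPolicy κ m r) : ℝ≥0∞ :=
  ∑ k : Fin κ, ∫⁻ z, ENNReal.ofReal (wsq W (G.state η γ z (k.val + 1) k.isLt)) ∂(G.law η)

/-- `∑ k, E ‖u k‖_W²`, an element of `[0, ∞]`. -/
def controlCost (G : Game κ m r Ω) (W : Matrix (Fin r) (Fin r) ℝ) (η : SignalingRule κ m)
    (γ : ControlPolicy κ m r) : ℝ≥0∞ :=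
  ∑ k : Fin κ, ∫⁻ z, ENNReal.ofReal (wsq W (G.control η γ z k)) ∂(G.law η)

/-- The objective of the type-`ω` follower. -/
def followerCost (G : Game κ m r Ω) (ω : Option Ω) (η : SignalingRule κ m)
    (γ : ControlPolicy κ m r) : ℝ≥0∞ :=
  G.stateCost (G.Q ω) η γ + G.controlCost (G.R ω) η γ

/-- The objective of the leader: the worst case over the distributions `p` of the type. -/
def leaderCost [Fintype Ω] (G : Game κ m r Ω) (η : SignalingRule κ m)
    (γ : Option Ω → ControlPolicy κ m r) : ℝ≥0∞ :=
  ⨆ p ∈ stdSimplex ℝ (Option Ω),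
    (∑ ω : Ω, ENNReal.ofReal (p (some ω)) * G.stateCost (G.Q none) η (γ (some ω)))
      + ENNReal.ofReal (p none) *
          (G.stateCost (G.Q none) η (γ none) + G.controlCost (G.R none) η (γ none))

/-- `γ` minimizes the objective of the type-`ω` follower when the leader plays `η`. -/
def IsBestResponse (G : Game κ m r Ω) (ω : Option Ω) (η : SignalingRule κ m)
    (γ : ControlPolicy κ m r) : Prop :=
  ∀ γ' : ControlPolicy κ m r, G.followerCost ω η γ ≤ G.followerCost ω η γ'

/-- Stackelberg equilibrium: `γ ω η'` is the reaction of the type-`ω` follower to the signaling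
rule `η'`; it is a best response to every `η'`, and `η` minimizes the objective of the leader
who anticipates these reactions. -/
def IsStackelbergEquilibrium [Fintype Ω] (G : Game κ m r Ω) (η : SignalingRule κ m)
    (γ : Option Ω → SignalingRule κ m → ControlPolicy κ m r) : Prop :=
  (∀ ω η', G.IsBestResponse ω η' (γ ω η')) ∧
    ∀ η', G.leaderCost η (fun ω => γ ω η) ≤ G.leaderCost η' (fun ω => γ ω η')

end Game

end SensorDesign

end

/-!
The inputs shift the signals by amounts which the follower knows, so every policy carries the
information of the control-free signals and leads to the same estimation errors. Completing the
squares with the Riccati recursion, the cost of a follower is a constant plus a weighted square of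
the deviation of its inputs from a linear function of the estimated state. All best responses thus
have almost surely the same inputs, and the objective of the leader depends only on the
covariances `H n` of the estimates of the control-free state, as a supremum of continuous functions.

These covariances satisfy `A H (n - 1) A' ≤ H n ≤ Σ n`, with `Σ n` the covariance of the
control-free state, and the sequences `H` with this property form a compact set. Each of them is
realized by the signals `(L n)' x n + θ n` with `(Σ n - A H (n - 1) A') L n = H n - A H (n - 1) A'`,
when the covariance of `θ n` is chosen to give the Kalman filter the identity as its gain. A
minimizer over the compact set is therefore attained by a signaling rule.
-/

noncomputable section

namespace SensorDesign

section WeightedSeminorm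

variable {d e l : ℕ}

/-- The continuous linear map `x ↦ M x` of Euclidean spaces, as a function of the matrix `M`. -/
def matCLM : Matrix (Fin e) (Fin d) ℝ ≃ₗ[ℝ] (Vec d →L[ℝ] Vec e) :=
  Matrix.toEuclideanLin.trans LinearMap.toContinuousLinearMap

theorem matCLM_apply (M : Matrix (Fin e) (Fin d) ℝ) (x : Vec d) :
    matCLM M x = Matrix.toEuclideanLin M x := rfl

theorem ofLp_matCLM (M : Matrix (Fin e) (Fin d) ℝ) (x : Vec d) :
    (matCLM M x).ofLp = M *ᵥ x.ofLp := rfl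

theorem matCLM_mul_apply (M : Matrix (Fin e) (Fin d) ℝ) (N : Matrix (Fin d) (Fin l) ℝ)
    (x : Vec l) : matCLM (M * N) x = matCLM M (matCLM N x) := by
  ext i
  simp only [ofLp_matCLM, Matrix.mulVec_mulVec]

theorem matCLM_one_apply (x : Vec d) : matCLM 1 x = x := by
  ext i
  simp only [ofLp_matCLM, Matrix.one_mulVec]

theorem wsq_nonneg {Q : Matrix (Fin d) (Fin d) ℝ} (hQ : Q.PosSemidef) (x : Vec d) :
    0 ≤ wsq Q x := by
  simpa only [wsq, star_trivial] using hQ.dotProduct_mulVec_nonneg x.ofLp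

theorem wsq_matCLM (Q : Matrix (Fin e) (Fin e) ℝ) (M : Matrix (Fin e) (Fin d) ℝ) (x : Vec d) :
    wsq Q (matCLM M x) = wsq (Mᵀ * Q * M) x := by
  rw [wsq, wsq, ofLp_matCLM, ← Matrix.mulVec_mulVec, ← Matrix.mulVec_mulVec,
    Matrix.dotProduct_mulVec x.ofLp, Matrix.vecMul_transpose]

theorem wsq_one (x : Vec d) : wsq 1 x = ‖x‖ ^ 2 := by
  rw [wsq, Matrix.one_mulVec, EuclideanSpace.real_norm_sq_eq, dotProduct]
  exact Finset.sum_congr rfl fun i _ => (sq _).symm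

open scoped MatrixOrder Matrix.Norms.L2Operator in
theorem exists_norm_sq_le_wsq {R : Matrix (Fin d) (Fin d) ℝ} (hR : R.PosDef) :
    ∃ c : ℝ, ∀ x : Vec d, ‖x‖ ^ 2 ≤ c * wsq R x := by
  obtain ⟨C, hC, rfl⟩ :=
    CStarAlgebra.isStrictlyPositive_iff_eq_star_mul_self.1 hR.isStrictlyPositive
  refine ⟨‖matCLM C⁻¹‖ ^ 2, fun x => ?_⟩
  have hwsq : wsq (star C * C) x = ‖matCLM C x‖ ^ 2 := by
    rw [← wsq_one, wsq_matCLM, mul_one, Matrix.star_eq_conjTranspose,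
      Matrix.conjTranspose_eq_transpose_of_trivial]
  have hx : x = matCLM C⁻¹ (matCLM C x) := by
    rw [← matCLM_mul_apply, Matrix.nonsing_inv_mul C ((Matrix.isUnit_iff_isUnit_det C).1 hC),
      matCLM_one_apply]
  rw [hwsq, ← mul_pow]
  nth_rw 1 [hx]
  gcongr
  exact (matCLM C⁻¹).le_opNorm _

end WeightedSeminorm

/-! ### Cross moments -/

section CrossMoment

variable {S : Type*} [MeasurableSpace S] {μ : Measure S} {d e l : ℕ}

/-- The matrix of cross moments `E[f g']` of two random vectors. For square-integrable ones, its
vanishing is their orthogonality. -/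
def crossMoment (μ : Measure S) (f : S → Vec d) (g : S → Vec e) : Matrix (Fin d) (Fin e) ℝ :=
  Matrix.of fun i j => ∫ z, f z i * g z j ∂μ

theorem crossMoment_apply (f : S → Vec d) (g : S → Vec e) (i : Fin d) (j : Fin e) :
    crossMoment μ f g i j = ∫ z, f z i * g z j ∂μ := rfl

theorem integrable_coord_mul_coord {f : S → Vec d} {g : S → Vec e} (hf : MemLp f 2 μ)
    (hg : MemLp g 2 μ) (i : Fin d) (j : Fin e) : Integrable (fun z => f z i * g z j) μ :=
  (hf.eval_piLp i).integrable_mul (hg.eval_piLp j)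

theorem transpose_crossMoment (f : S → Vec d) (g : S → Vec e) :
    (crossMoment μ f g)ᵀ = crossMoment μ g f := by
  ext i j
  simp only [Matrix.transpose_apply, crossMoment_apply, mul_comm]

theorem crossMoment_eq_zero_comm {f : S → Vec d} {g : S → Vec e} :
    crossMoment μ f g = 0 ↔ crossMoment μ g f = 0 := by
  rw [← transpose_crossMoment, Matrix.transpose_eq_zero]

theorem crossMoment_zero_left (g : S → Vec e) : crossMoment μ (0 : S → Vec d) g = 0 := by
  ext i j
  simp [crossMoment_apply]

theorem crossMoment_add_left {f f' : S → Vec d} {g : S → Vec e} (hf : MemLp f 2 μ)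
    (hf' : MemLp f' 2 μ) (hg : MemLp g 2 μ) :
    crossMoment μ (f + f') g = crossMoment μ f g + crossMoment μ f' g := by
  ext i j
  simp only [crossMoment_apply, Matrix.add_apply, Pi.add_apply, PiLp.add_apply, add_mul]
  exact integral_add (integrable_coord_mul_coord hf hg i j) (integrable_coord_mul_coord hf' hg i j)

theorem crossMoment_neg_left (f : S → Vec d) (g : S → Vec e) :
    crossMoment μ (-f) g = -crossMoment μ f g := by
  ext i j
  simp [crossMoment_apply, integral_neg]

theorem crossMoment_sub_left {f f' : S → Vec d} {g : S → Vec e} (hf : MemLp f 2 μ)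
    (hf' : MemLp f' 2 μ) (hg : MemLp g 2 μ) :
    crossMoment μ (f - f') g = crossMoment μ f g - crossMoment μ f' g := by
  rw [sub_eq_add_neg, crossMoment_add_left hf hf'.neg hg, crossMoment_neg_left, ← sub_eq_add_neg]

theorem crossMoment_add_right {f : S → Vec d} {g g' : S → Vec e} (hf : MemLp f 2 μ)
    (hg : MemLp g 2 μ) (hg' : MemLp g' 2 μ) :
    crossMoment μ f (g + g') = crossMoment μ f g + crossMoment μ f g' := by
  simp only [← transpose_crossMoment _ f, crossMoment_add_left hg hg' hf, Matrix.transpose_add]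

theorem crossMoment_sub_right {f : S → Vec d} {g g' : S → Vec e} (hf : MemLp f 2 μ)
    (hg : MemLp g 2 μ) (hg' : MemLp g' 2 μ) :
    crossMoment μ f (g - g') = crossMoment μ f g - crossMoment μ f g' := by
  simp only [← transpose_crossMoment _ f, crossMoment_sub_left hg hg' hf, Matrix.transpose_sub]

theorem crossMoment_add_self {f g : S → Vec d} (hf : MemLp f 2 μ) (hg : MemLp g 2 μ)
    (h : crossMoment μ f g = 0) :
    crossMoment μ (f + g) (f + g) = crossMoment μ f f + crossMoment μ g g := by
  rw [crossMoment_add_left hf hg (hf.add hg), crossMoment_add_right hf hf hg,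
    crossMoment_add_right hg hf hg, h, crossMoment_eq_zero_comm.1 h, add_zero, zero_add]

theorem crossMoment_comp_left (M : Matrix (Fin l) (Fin d) ℝ) {f : S → Vec d} {g : S → Vec e}
    (hf : MemLp f 2 μ) (hg : MemLp g 2 μ) :
    crossMoment μ (matCLM M ∘ f) g = M * crossMoment μ f g := by
  ext i j
  simp only [crossMoment_apply, Function.comp_apply, ofLp_matCLM, Matrix.mulVec, dotProduct,
    Matrix.mul_apply, Finset.sum_mul, mul_assoc]
  rw [integral_finsetSum _ fun k _ => (integrable_coord_mul_coord hf hg k j).const_mul _]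
  simp only [integral_const_mul]

theorem crossMoment_comp_right (M : Matrix (Fin l) (Fin e) ℝ) {f : S → Vec d} {g : S → Vec e}
    (hf : MemLp f 2 μ) (hg : MemLp g 2 μ) :
    crossMoment μ f (matCLM M ∘ g) = crossMoment μ f g * Mᵀ := by
  rw [← transpose_crossMoment, crossMoment_comp_left M hg hf, Matrix.transpose_mul,
    transpose_crossMoment]

theorem crossMoment_comp_self (M : Matrix (Fin l) (Fin d) ℝ) {f : S → Vec d} (hf : MemLp f 2 μ) :
    crossMoment μ (matCLM M ∘ f) (matCLM M ∘ f) = M * crossMoment μ f f * Mᵀ := by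
  rw [crossMoment_comp_left M hf ((matCLM M).comp_memLp' hf), crossMoment_comp_right M hf hf,
    Matrix.mul_assoc]

theorem crossMoment_comp_measurePreserving {T : Type*} [MeasurableSpace T] {ν : Measure T}
    {Z : S → T} (hZ : MeasurePreserving Z μ ν) {f : T → Vec d} {g : T → Vec e} (hf : Measurable f)
    (hg : Measurable g) : crossMoment μ (f ∘ Z) (g ∘ Z) = crossMoment ν f g := by
  ext i j
  have hfg : Measurable fun x => f x i * g x j := by fun_prop
  rw [crossMoment_apply, crossMoment_apply, ← hZ.map_eq,
    integral_map hZ.aemeasurable hfg.aestronglyMeasurable]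
  rfl

theorem integrable_wsq (Q : Matrix (Fin d) (Fin d) ℝ) {f : S → Vec d} (hf : MemLp f 2 μ) :
    Integrable (fun z => wsq Q (f z)) μ := by
  simp only [wsq, dotProduct]
  exact integrable_finsetSum _ fun i _ => (hf.eval_piLp i).integrable_mul
    (((matCLM Q).comp_memLp' hf).eval_piLp i)

theorem integral_wsq (Q : Matrix (Fin d) (Fin d) ℝ) {f : S → Vec d} (hf : MemLp f 2 μ) :
    ∫ z, wsq Q (f z) ∂μ = (Q * crossMoment μ f f).trace := by
  have hQf := (matCLM Q).comp_memLp' hf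
  rw [← crossMoment_comp_left Q hf hf, ← Matrix.trace_transpose, transpose_crossMoment]
  simp only [wsq, dotProduct, Matrix.trace, Matrix.diag]
  exact integral_finsetSum _ fun i _ => integrable_coord_mul_coord hf hQf i i

theorem lintegral_wsq {Q : Matrix (Fin d) (Fin d) ℝ} (hQ : Q.PosSemidef) {f : S → Vec d}
    (hf : MemLp f 2 μ) :
    ∫⁻ z, ENNReal.ofReal (wsq Q (f z)) ∂μ = ENNReal.ofReal (∫ z, wsq Q (f z) ∂μ) :=
  (ofReal_integral_eq_lintegral_ofReal (integrable_wsq Q hf)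
    (.of_forall fun z => wsq_nonneg hQ (f z))).symm

theorem integral_wsq_nonneg {Q : Matrix (Fin d) (Fin d) ℝ} (hQ : Q.PosSemidef) (f : S → Vec d) :
    0 ≤ ∫ z, wsq Q (f z) ∂μ :=
  integral_nonneg fun z => wsq_nonneg hQ (f z)

theorem integral_wsq_add (Q : Matrix (Fin d) (Fin d) ℝ) {f g : S → Vec d} (hf : MemLp f 2 μ)
    (hg : MemLp g 2 μ) (h : crossMoment μ f g = 0) :
    ∫ z, wsq Q (f z + g z) ∂μ = ∫ z, wsq Q (f z) ∂μ + ∫ z, wsq Q (g z) ∂μ := by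
  rw [integral_wsq Q hf, integral_wsq Q hg, ← Matrix.trace_add, ← mul_add,
    ← crossMoment_add_self hf hg h, ← integral_wsq Q (hf.add hg)]
  rfl

theorem ae_eq_zero_of_integral_wsq_eq_zero {R : Matrix (Fin d) (Fin d) ℝ} (hR : R.PosDef)
    {f : S → Vec d} (hf : MemLp f 2 μ) (h : ∫ z, wsq R (f z) ∂μ = 0) : f =ᵐ[μ] 0 := by
  obtain ⟨c, hc⟩ := exists_norm_sq_le_wsq hR
  rw [integral_eq_zero_iff_of_nonneg (fun z => wsq_nonneg hR.posSemidef (f z))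
    (integrable_wsq R hf)] at h
  filter_upwards [h] with z hz
  have hnorm : ‖f z‖ ^ 2 ≤ 0 := by simpa only [hz, Pi.zero_apply, mul_zero] using hc (f z)
  exact norm_eq_zero.1 (pow_eq_zero_iff two_ne_zero |>.1 (hnorm.antisymm (sq_nonneg _)))

theorem posSemidef_crossMoment_self {f : S → Vec d} (hf : MemLp f 2 μ) :
    (crossMoment μ f f).PosSemidef := by
  refine .of_dotProduct_mulVec_nonneg ?_ fun x => ?_
  · rw [Matrix.IsHermitian, Matrix.conjTranspose_eq_transpose_of_trivial, transpose_crossMoment]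
  · have hX := Matrix.posSemidef_vecMulVec_self_star x
    have h := integral_wsq_nonneg (μ := μ) hX f
    rwa [integral_wsq _ hf, Matrix.vecMulVec_mul, Matrix.trace_vecMulVec, dotProduct_comm,
      ← Matrix.dotProduct_mulVec] at h

theorem memLp_two_of_lintegral_wsq_ne_top {R : Matrix (Fin d) (Fin d) ℝ} (hR : R.PosDef)
    {f : S → Vec d} (hf : Measurable f) (h : ∫⁻ z, ENNReal.ofReal (wsq R (f z)) ∂μ ≠ ∞) :
    MemLp f 2 μ := by
  obtain ⟨c, hc⟩ := exists_norm_sq_le_wsq hR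
  have hmeas : Measurable fun z => wsq R (f z) := by
    simp only [wsq, dotProduct, Matrix.mulVec]
    fun_prop
  have hint := (lintegral_ofReal_ne_top_iff_integrable hmeas.aestronglyMeasurable
    (.of_forall fun z => wsq_nonneg hR.posSemidef (f z))).1 h
  rw [memLp_two_iff_integrable_sq_norm hf.aestronglyMeasurable]
  refine (hint.const_mul c).mono' (hf.norm.pow_const 2).aestronglyMeasurable
    (.of_forall fun z => ?_)
  rw [Real.norm_of_nonneg (sq_nonneg _)]
  exact hc (f z)

end CrossMoment

theorem crossMoment_sub_condExp_eq_zero {S : Type*} {d e : ℕ} {𝓕 m0 : MeasurableSpace S}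
    {μ : Measure[m0] S} [IsFiniteMeasure μ] (h𝓕 : 𝓕 ≤ m0) {f : S → Vec d} {h : S → Vec e}
    (hf : MemLp f 2 μ) (hh : Measurable[𝓕] h) (hh2 : MemLp h 2 μ) :
    crossMoment μ (f - μ[f | 𝓕]) h = 0 := by
  rw [crossMoment_sub_left hf (hf.condExp one_le_two) hh2, sub_eq_zero]
  ext i j
  have hj : StronglyMeasurable[𝓕] fun z => h z j :=
    ((EuclideanSpace.proj j).continuous.measurable.comp hh).stronglyMeasurable
  have hcoord := (EuclideanSpace.proj i : Vec d →L[ℝ] ℝ).comp_condExp_comm (m := 𝓕)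
    (hf.integrable one_le_two)
  rw [crossMoment_apply, crossMoment_apply, ← integral_condExp h𝓕]
  refine integral_congr_ae ((condExp_mul_of_stronglyMeasurable_right hj
    (integrable_coord_mul_coord hf hh2 i j)
    ((hf.eval_piLp i).integrable one_le_two)).trans ?_)
  filter_upwards [hcoord] with z hz
  exact congrArg (· * h z j) hz.symm

/-! ### Centered Gaussian measures -/

section Gaussian

variable {d e : ℕ}

theorem integral_coord_eq_zero {S : Type*} [MeasurableSpace S] {μ : Measure S} {f : S → Vec d}
    (hf : Integrable f μ) (hf0 : ∫ z, f z ∂μ = 0) (i : Fin d) : ∫ z, f z i ∂μ = 0 := by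
  rw [← eval_integral_piLp fun i => hf.eval_piLp i, hf0, PiLp.zero_apply]

theorem crossMoment_eq_zero_of_indepFun {S : Type*} [MeasurableSpace S] {μ : Measure S}
    {f : S → Vec d} {g : S → Vec e} (h : IndepFun f g μ) (hf : Integrable f μ)
    (hf0 : ∫ z, f z ∂μ = 0) (hg : AEStronglyMeasurable g μ) : crossMoment μ f g = 0 := by
  ext i j
  have hij : IndepFun (fun z => f z i) (fun z => g z j) μ :=
    h.comp (EuclideanSpace.proj i).continuous.measurable
      (EuclideanSpace.proj j).continuous.measurable
  rw [crossMoment_apply, hij.integral_fun_mul_eq_mul_integral (hf.eval_piLp i).1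
    ((EuclideanSpace.proj j).continuous.comp_aestronglyMeasurable hg),
    integral_coord_eq_zero hf hf0, zero_mul,
    Matrix.zero_apply]

theorem crossMoment_multivariateGaussian {C : Matrix (Fin d) (Fin d) ℝ} (hC : C.PosSemidef) :
    crossMoment (multivariateGaussian 0 C) id id = C := by
  ext i j
  have hL2 : ∀ i, MemLp (fun x : Vec d => x i) 2 (multivariateGaussian 0 C) :=
    IsGaussian.memLp_two_id.eval_piLp
  rw [← covariance_eval_multivariateGaussian (μ := 0) hC i j, covariance_eq_sub (hL2 i) (hL2 j),
    integral_coord_eq_zero IsGaussian.integrable_fun_id integral_id_multivariateGaussian, zero_mul,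
    sub_zero]
  rfl

theorem integral_id_prod {E F : Type*} [NormedAddCommGroup E] [NormedSpace ℝ E] [CompleteSpace E]
    [MeasurableSpace E] [NormedAddCommGroup F] [NormedSpace ℝ F] [CompleteSpace F]
    [MeasurableSpace F] {μ : Measure E} {ν : Measure F} [IsProbabilityMeasure μ]
    [IsProbabilityMeasure ν] (hμ : Integrable id μ) (hν : Integrable id ν) :
    ∫ z, z ∂(μ.prod ν) = (∫ x, x ∂μ, ∫ y, y ∂ν) := by
  have hz : Integrable (fun z => z) (μ.prod ν) := (hμ.comp_fst ν).prodMk (hν.comp_snd μ)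
  refine Prod.ext ?_ ?_
  · rw [fst_integral hz, integral_fun_fst (fun x => x), probReal_univ, one_smul]
  · rw [snd_integral hz, integral_fun_snd (fun x => x), probReal_univ, one_smul]

section Pi

variable {ι : Type*} [Fintype ι] {E : ι → Type*} [∀ i, NormedAddCommGroup (E i)]
  [∀ i, NormedSpace ℝ (E i)] [∀ i, MeasurableSpace (E i)] [∀ i, CompleteSpace (E i)]
  {μ : ∀ i, Measure (E i)}

theorem integral_id_pi [∀ i, IsProbabilityMeasure (μ i)] (h : ∀ i, Integrable id (μ i)) :
    ∫ x, x ∂(Measure.pi μ) = fun i => ∫ y, y ∂(μ i) := by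
  funext i
  rw [eval_integral (f := fun x => x) fun i =>
      (measurePreserving_eval μ i).integrable_comp_of_integrable (h i),
    ← (measurePreserving_eval μ i).map_eq, integral_map (measurable_pi_apply i).aemeasurable]
  · rw [(measurePreserving_eval μ i).map_eq]
    exact (h i).1

instance isGaussian_pi [∀ i, BorelSpace (E i)] [∀ i, SecondCountableTopology (E i)]
    [∀ i, IsGaussian (μ i)] : IsGaussian (Measure.pi μ) := by
  have hlaw : ∀ i, HasGaussianLaw (fun x : ∀ i, E i => x i) (Measure.pi μ) := fun i =>
    ⟨by simpa only [(measurePreserving_eval μ i).map_eq] using inferInstanceAs (IsGaussian (μ i))⟩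
  have h := (iIndepFun.hasGaussianLaw hlaw
    (iIndepFun_pi (X := fun i (x : E i) => x) fun i => aemeasurable_id)).isGaussian_map
  rwa [show (fun (x : ∀ i, E i) i => x i) = id from rfl, Measure.map_id] at h

end Pi

section Linear

variable {E : Type*} [NormedAddCommGroup E] [NormedSpace ℝ E] [MeasurableSpace E] [BorelSpace E]
  {μ : Measure E} [IsGaussian μ]

theorem memLp_two_clm (f : E →L[ℝ] Vec d) : MemLp f 2 μ :=
  (IsGaussian.hasGaussianLaw_id.map_fun f).memLp_two

variable [CompleteSpace E] [SecondCountableTopology E]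

theorem integral_clm_eq_zero (hμ : ∫ z, z ∂μ = 0) (f : E →L[ℝ] Vec d) : ∫ z, f z ∂μ = 0 := by
  rw [f.integral_comp_comm (φ := fun z => z) IsGaussian.integrable_id, hμ, map_zero]

theorem indepFun_of_crossMoment_eq_zero (hμ : ∫ z, z ∂μ = 0) {ι : Type*} [Finite ι]
    (f : E →L[ℝ] Vec d) (y : ι → E →L[ℝ] Vec e) (h : ∀ j, crossMoment μ f (y j) = 0) :
    IndepFun f (fun z j => y j z) μ := by
  have hcov : ∀ (i : Fin d) (p : ι × Fin e), cov[fun z => f z i, fun z => y p.1 z p.2; μ] = 0 := by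
    intro i p
    rw [covariance_eq_sub ((memLp_two_clm f).eval_piLp i) ((memLp_two_clm (y p.1)).eval_piLp p.2),
      integral_coord_eq_zero ((memLp_two_clm f).integrable one_le_two)
        (integral_clm_eq_zero hμ f), zero_mul, sub_zero]
    exact congrFun₂ (h p.1) i p.2
  have := Fintype.ofFinite ι
  let L : E →L[ℝ] (Fin d → ℝ) × (ι × Fin e → ℝ) :=
    (ContinuousLinearMap.pi fun i => (EuclideanSpace.proj i : Vec d →L[ℝ] ℝ) ∘L f).prod
      (ContinuousLinearMap.pi fun p => (EuclideanSpace.proj p.2 : Vec e →L[ℝ] ℝ) ∘L y p.1)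
  have hgauss : HasGaussianLaw (fun z => L z) μ :=
    (IsGaussian.hasGaussianLaw_id (μ := μ)).map_fun L
  exact (hgauss.indepFun_of_covariance_eval hcov).comp
    (φ := fun x => (WithLp.toLp 2 x : Vec d))
    (ψ := fun x j => (WithLp.toLp 2 fun l => x (j, l) : Vec e))
    (WithLp.measurable_toLp 2 _) (measurable_pi_lambda _ fun j =>
      (WithLp.measurable_toLp 2 _).comp (measurable_pi_lambda _ fun l => measurable_pi_apply _))

end Linear

end Gaussian

/-! ### Control-free signals and adapted inputs -/

variable {κ m r : ℕ} {Ω : Type*}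

/-- The state noise after stage `n`, set to zero beyond the horizon. -/
def stateNoise (n : ℕ) : Sample κ m →L[ℝ] Vec m :=
  if h : n < κ then .proj ⟨n, h⟩ ∘L .fst ℝ _ _ ∘L .snd ℝ _ _ else 0

/-- The noise added to the signal at stage `k`. -/
def signalNoise (k : Fin κ) : Sample κ m →L[ℝ] Vec m :=
  .proj k ∘L .snd ℝ _ _ ∘L .snd ℝ _ _

theorem stateNoise_apply (k : Fin κ) (z : Sample κ m) : stateNoise k z = z.2.1 k := by
  simp [stateNoise]

theorem stateNoise_of_le {n : ℕ} (h : κ ≤ n) : stateNoise (κ := κ) (m := m) n = 0 :=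
  dif_neg h.not_gt

/-- The noiseless part of the signal at stage `k` when the states are `x`. -/
def SignalingRule.observe (η : SignalingRule κ m) (k : Fin κ) (x : ℕ → Vec m) : Vec m :=
  ∑ i : Fin (k.val + 1), matCLM (η.gain k i)ᵀ (x i)

theorem SignalingRule.observe_add (η : SignalingRule κ m) (k : Fin κ) (x y : ℕ → Vec m) :
    η.observe k (x + y) = η.observe k x + η.observe k y := by
  simp only [observe, Pi.add_apply, map_add, Finset.sum_add_distrib]

theorem SignalingRule.observe_congr (η : SignalingRule κ m) {k : Fin κ} {x y : ℕ → Vec m}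
    (h : ∀ i ≤ k.val, x i = y i) : η.observe k x = η.observe k y :=
  Finset.sum_congr rfl fun i _ => by rw [h i (Nat.lt_succ_iff.1 i.isLt)]

theorem SignalingRule.measurable_observe {S : Type*} {_ : MeasurableSpace S}
    (η : SignalingRule κ m) {k : Fin κ} {x : S → ℕ → Vec m}
    (hx : ∀ i ≤ k.val, Measurable fun s => x s i) : Measurable fun s => η.observe k (x s) :=
  Finset.measurable_sum _ fun i _ =>
    (matCLM _).continuous.measurable.comp (hx i (Nat.lt_succ_iff.1 i.isLt))

namespace Game

variable (G : Game κ m r Ω) (η : SignalingRule κ m)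

/-- The state when no control is applied. -/
def free : ℕ → Sample κ m →L[ℝ] Vec m
  | 0 => .fst ℝ _ _
  | n + 1 => matCLM G.A ∘L free n + stateNoise n

/-- The signal when no control is applied. -/
def freeSignal (k : Fin κ) : Sample κ m →L[ℝ] Vec m :=
  ∑ i : Fin (k.val + 1), matCLM (η.gain k i)ᵀ ∘L G.free i + signalNoise k

/-- The contribution of the inputs `u` to the state. -/
def driven (u : ℕ → Vec r) : ℕ → Vec m
  | 0 => 0
  | n + 1 => matCLM G.A (driven u n) + matCLM G.B (u n)

/-- The inputs generated by a policy, set to zero beyond the horizon. -/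
def input (γ : ControlPolicy κ m r) (z : Sample κ m) (n : ℕ) : Vec r :=
  if h : n < κ then G.control η γ z ⟨n, h⟩ else 0

/-- The information carried by the control-free signals of the first `n` stages. It is the
information of the actual signals, whatever the policy. -/
@[reducible] def signalAlgebra (n : ℕ) : MeasurableSpace (Sample κ m) :=
  MeasurableSpace.comap (fun z (j : {j : Fin κ // j.val < n}) => G.freeSignal η j z) inferInstance

theorem freeSignal_apply (k : Fin κ) (z : Sample κ m) :
    G.freeSignal η k z = η.observe k (G.free · z) + signalNoise k z := by
  simp [freeSignal, SignalingRule.observe]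

theorem signalAlgebra_le (n : ℕ) :
    G.signalAlgebra η n ≤ (inferInstance : MeasurableSpace (Sample κ m)) :=
  (measurable_pi_lambda _ fun j : {j : Fin κ // j.val < n} =>
    (G.freeSignal η j).continuous.measurable).comap_le

theorem measurable_freeSignal {k : Fin κ} {n : ℕ} (h : k.val < n) :
    Measurable[G.signalAlgebra η n] (G.freeSignal η k) :=
  (measurable_pi_apply (⟨k, h⟩ : {j : Fin κ // j.val < n})).comp
    (comap_measurable fun z (j : {j : Fin κ // j.val < n}) => G.freeSignal η j z)

theorem signalAlgebra_mono {n l : ℕ} (h : n ≤ l) : G.signalAlgebra η n ≤ G.signalAlgebra η l :=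
  Measurable.comap_le (@measurable_pi_lambda _ _ _ (G.signalAlgebra η l) _ _ fun j =>
    G.measurable_freeSignal η (j.2.trans_le h))

theorem driven_congr {u v : ℕ → Vec r} {n : ℕ} (h : ∀ i < n, u i = v i) :
    G.driven u n = G.driven v n := by
  induction n with
  | zero => rfl
  | succ n ih =>
    rw [driven, driven, ih fun i hi => h i (hi.trans n.lt_succ_self), h n n.lt_succ_self]

theorem measurable_driven {S : Type*} {_ : MeasurableSpace S} {u : S → ℕ → Vec r} {n : ℕ}
    (h : ∀ i < n, Measurable fun s => u s i) : Measurable fun s => G.driven (u s) n := by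
  induction n with
  | zero => exact measurable_const
  | succ n ih =>
    exact ((matCLM G.A).continuous.measurable.comp
      (ih fun i hi => h i (hi.trans n.lt_succ_self))).add
        ((matCLM G.B).continuous.measurable.comp (h n n.lt_succ_self))

section Policy

variable (γ : ControlPolicy κ m r) (z : Sample κ m)

theorem input_coe (k : Fin κ) : G.input η γ z k = G.control η γ z k := by
  simp [input]

theorem state_eq (n : ℕ) (h : n ≤ κ) :
    G.state η γ z n h = G.free n z + G.driven (G.input η γ z) n := by
  induction n with
  | zero => simp [state_zero, free, driven]
  | succ n ih =>
    rw [G.state_succ η γ z ⟨n, h⟩, ih (n.le_succ.trans h), ← input_coe, ← stateNoise_apply,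
      ← matCLM_apply, ← matCLM_apply, map_add]
    simp only [free, driven, _root_.add_apply, ContinuousLinearMap.comp_apply]
    abel

theorem signal_eq (k : Fin κ) :
    G.signal η γ z k = G.freeSignal η k z + η.observe k (G.driven (G.input η γ z)) := by
  rw [freeSignal_apply, add_right_comm, ← SignalingRule.observe_add]
  simp only [signal, state_eq]
  rfl

theorem measurable_input (n : ℕ) :
    Measurable[G.signalAlgebra η (n + 1)] fun z => G.input η γ z n := by
  induction n using Nat.strong_induction_on with
  | _ n ih =>
    by_cases h : n < κ
    · simp only [input, h, dif_pos]
      refine (γ.measurable_act ⟨n, h⟩).comp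
        (@measurable_pi_lambda _ _ _ (G.signalAlgebra η (n + 1)) _ _ fun j => ?_)
      simp only [signal_eq]
      refine (G.measurable_freeSignal η j.isLt).add
        (η.measurable_observe fun i hi => G.measurable_driven fun i' hi' => ?_)
      have hn : i' < n := hi'.trans_le (hi.trans (Nat.lt_succ_iff.1 j.isLt))
      exact (ih i' hn).mono (G.signalAlgebra_mono η (by omega)) le_rfl
    · simp only [input, h, dif_neg, not_false_eq_true]
      exact measurable_const

end Policy

section Replay

variable (f : Fin κ → (Fin κ → Vec m) → Vec r)

/-- The inputs reconstructed from the actual signals `s` when the input at stage `k` is the function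
`f k` of the control-free signals: the contribution of the earlier inputs is subtracted from the
signals. -/
def replay (s : Fin κ → Vec m) (n : ℕ) : Vec r :=
  if h : n < κ then
    f ⟨n, h⟩ fun j => s j - η.observe j (G.driven fun i => if i < n then replay s i else 0)
  else 0

variable {f}

theorem measurable_replay (hf : ∀ k, Measurable (f k)) (n : ℕ) :
    Measurable fun s => G.replay η f s n := by
  induction n using Nat.strong_induction_on with
  | _ n ih =>
    unfold replay
    split_ifs with h
    · refine (hf _).comp (measurable_pi_lambda _ fun j => (measurable_pi_apply j).sub
        (η.measurable_observe fun i _ => G.measurable_driven fun i' _ => ?_))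
      split_ifs with hi
      exacts [ih i' hi, measurable_const]
    · exact measurable_const

theorem replay_eq (hf : ∀ k, DependsOn (f k) (Set.Iic k)) (s : Fin κ → Vec m) (k : Fin κ) :
    G.replay η f s k = f k fun j => s j - η.observe j (G.driven (G.replay η f s)) := by
  rw [replay, dif_pos k.isLt]
  refine hf k fun j hj => congrArg (s j - ·) (η.observe_congr fun i hi => G.driven_congr ?_)
  intro i' hi'
  exact if_pos (hi'.trans_le (hi.trans hj))

theorem replay_congr (hf : ∀ k, DependsOn (f k) (Set.Iic k)) {s t : Fin κ → Vec m} {n : ℕ}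
    (h : ∀ j : Fin κ, j.val ≤ n → s j = t j) : G.replay η f s n = G.replay η f t n := by
  induction n using Nat.strong_induction_on with
  | _ n ih =>
    by_cases hn : n < κ
    · rw [G.replay_eq η hf s ⟨n, hn⟩, G.replay_eq η hf t ⟨n, hn⟩]
      refine hf _ fun j hj => congrArg₂ (· - ·) (h j hj)
        (η.observe_congr fun i hi => G.driven_congr fun i' hi' => ?_)
      have hlt : i' < n := hi'.trans_le (hi.trans hj)
      exact ih i' hlt fun j hj => h j (hj.trans hlt.le)
    · rw [replay, replay, dif_neg hn, dif_neg hn]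

theorem exists_policy {u : ℕ → Sample κ m → Vec r}
    (hu : ∀ n, Measurable[G.signalAlgebra η (n + 1)] (u n)) :
    ∃ γ : ControlPolicy κ m r, ∀ z, ∀ n < κ, G.input η γ z n = u n z := by
  choose g hg hgu using fun n => (hu n).exists_eq_measurable_comp
  let f : Fin κ → (Fin κ → Vec m) → Vec r := fun k y => g k fun j => y j
  have hf : ∀ k, DependsOn (f k) (Set.Iic k) := fun k y y' h =>
    congrArg (g k) (funext fun j => h j (Nat.lt_succ_iff.1 j.2))
  have hfm : ∀ k, Measurable (f k) := fun k =>
    (hg k).comp (measurable_pi_lambda _ fun j => measurable_pi_apply _)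
  let extend (k : Fin κ) (s : Fin (k.val + 1) → Vec m) (j : Fin κ) : Vec m :=
    if h : j.val < k.val + 1 then s ⟨j, h⟩ else 0
  have hextend : ∀ k, Measurable (extend k) := fun k => measurable_pi_lambda _ fun j => by
    simp only [extend]
    split_ifs <;> fun_prop
  let γ : ControlPolicy κ m r :=
    { act := fun k s => G.replay η f (extend k s) k
      measurable_act := fun k => (G.measurable_replay η hfm k).comp (hextend k) }
  have hγ : ∀ z (k : Fin κ), G.input η γ z k = G.replay η f (G.signal η γ z) k := fun z k => by
    rw [input_coe]
    exact G.replay_congr η hf fun j hj => dif_pos (Nat.lt_succ_iff.2 hj)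
  refine ⟨γ, fun z n hn => ?_⟩
  rw [hγ z ⟨n, hn⟩, G.replay_eq η hf, hgu n]
  refine congrArg (g n) (funext fun j => ?_)
  beta_reduce
  rw [signal_eq, add_sub_assoc, add_eq_left, sub_eq_zero]
  refine η.observe_congr fun i hi => G.driven_congr fun i' hi' => ?_
  exact hγ z ⟨i', hi'.trans_le (hi.trans j.1.isLt.le)⟩

end Replay

end Game

/-! ### Orthogonality of the primitive random variables -/

theorem crossMoment_sum_right {S ι : Type*} [MeasurableSpace S] {μ : Measure S} {d e : ℕ}
    (s : Finset ι) {f : S → Vec d} {g : ι → S → Vec e} (hf : MemLp f 2 μ)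
    (hg : ∀ i, MemLp (g i) 2 μ) :
    crossMoment μ f (∑ i ∈ s, g i) = ∑ i ∈ s, crossMoment μ f (g i) := by
  classical
  induction s using Finset.induction_on with
  | empty =>
    rw [Finset.sum_empty, Finset.sum_empty, crossMoment_eq_zero_comm, crossMoment_zero_left]
  | insert a s ha ih =>
    rw [Finset.sum_insert ha, Finset.sum_insert ha, ← ih,
      crossMoment_add_right hf (hg a) (memLp_finsetSum' s fun i _ => hg i)]

theorem crossMoment_pi_multivariateGaussian_self {ι : Type*} [Fintype ι] {d : ℕ}
    {C : ι → Matrix (Fin d) (Fin d) ℝ} {k : ι} (hC : (C k).PosSemidef) :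
    crossMoment (Measure.pi fun k => multivariateGaussian (0 : Vec d) (C k)) (Function.eval k)
      (Function.eval k) = C k := by
  rw [← crossMoment_multivariateGaussian hC]
  exact crossMoment_comp_measurePreserving (f := id) (g := id)
    (measurePreserving_eval (fun k => multivariateGaussian (0 : Vec d) (C k)) k) measurable_id
    measurable_id

theorem crossMoment_pi_multivariateGaussian_of_ne {ι : Type*} [Fintype ι] {d : ℕ}
    (C : ι → Matrix (Fin d) (Fin d) ℝ) {k l : ι} (hkl : k ≠ l) :
    crossMoment (Measure.pi fun k => multivariateGaussian (0 : Vec d) (C k)) (Function.eval k)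
      (Function.eval l) = 0 := by
  have hint : Integrable id (Measure.pi fun k => multivariateGaussian (0 : Vec d) (C k)) :=
    IsGaussian.integrable_id
  refine crossMoment_eq_zero_of_indepFun
    ((iIndepFun_pi (X := fun _ (x : Vec d) => x) fun _ => aemeasurable_id).indepFun hkl)
    (hint.eval k) ?_ (measurable_pi_apply l).aestronglyMeasurable
  exact (eval_integral (f := id) hint.eval k).symm.trans (by
    simp [integral_id_pi fun _ => IsGaussian.integrable_id])

namespace Game

variable (G : Game κ m r Ω) (η : SignalingRule κ m)

instance isGaussian_law : IsGaussian (G.law η) := by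
  unfold law
  infer_instance

theorem integral_law : ∫ z, z ∂(G.law η) = 0 := by
  simp only [law, integral_id_prod IsGaussian.integrable_id IsGaussian.integrable_id,
    integral_id_pi fun _ => IsGaussian.integrable_id, integral_id_multivariateGaussian]
  rfl

variable {G η}

theorem measurePreserving_stateNoise :
    MeasurePreserving (fun z : Sample κ m => z.2.1) (G.law η)
      (Measure.pi fun _ => multivariateGaussian 0 G.covNoise) :=
  measurePreserving_fst.comp measurePreserving_snd

theorem measurePreserving_signalNoise :
    MeasurePreserving (fun z : Sample κ m => z.2.2) (G.law η)
      (Measure.pi fun k => multivariateGaussian 0 (η.noiseCov k)) :=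
  measurePreserving_snd.comp measurePreserving_snd

theorem indepFun_noises :
    IndepFun (fun z : Sample κ m => z.2.1) (fun z => z.2.2) (G.law η) := by
  rw [indepFun_iff_map_prod_eq_prod_map_map (by fun_prop) (by fun_prop),
    measurePreserving_stateNoise.map_eq, measurePreserving_signalNoise.map_eq]
  exact measurePreserving_snd.map_eq

theorem crossMoment_free_zero_self (hInit : G.covInit.PosSemidef) :
    crossMoment (G.law η) (G.free 0) (G.free 0) = G.covInit := by
  rw [← crossMoment_multivariateGaussian hInit]
  exact crossMoment_comp_measurePreserving (f := id) (g := id) measurePreserving_fst measurable_id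
    measurable_id

theorem crossMoment_stateNoise_self (hNoise : G.covNoise.PosSemidef) (k : Fin κ) :
    crossMoment (G.law η) (stateNoise k) (stateNoise k) = G.covNoise := by
  rw [← crossMoment_pi_multivariateGaussian_self (C := fun _ : Fin κ => G.covNoise) (k := k) hNoise,
    ← crossMoment_comp_measurePreserving measurePreserving_stateNoise (measurable_pi_apply k)
      (measurable_pi_apply k), funext (stateNoise_apply k)]
  rfl

theorem crossMoment_signalNoise_self (k : Fin κ) :
    crossMoment (G.law η) (signalNoise k) (signalNoise k) = η.noiseCov k := by
  rw [← crossMoment_pi_multivariateGaussian_self (η.noiseCov_posSemidef k)]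
  exact crossMoment_comp_measurePreserving measurePreserving_signalNoise (measurable_pi_apply k)
    (measurable_pi_apply k)

theorem crossMoment_signalNoise_of_ne {k l : Fin κ} (h : k ≠ l) :
    crossMoment (G.law η) (signalNoise k) (signalNoise l) = 0 := by
  rw [← crossMoment_pi_multivariateGaussian_of_ne η.noiseCov h]
  exact crossMoment_comp_measurePreserving measurePreserving_signalNoise (measurable_pi_apply k)
    (measurable_pi_apply l)

theorem crossMoment_stateNoise_of_ne {n l : ℕ} (h : n ≠ l) :
    crossMoment (G.law η) (stateNoise n) (stateNoise l) = 0 := by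
  rcases le_or_gt κ n with hn | hn
  · rw [stateNoise_of_le hn]
    exact crossMoment_zero_left _
  rcases le_or_gt κ l with hl | hl
  · rw [stateNoise_of_le hl, crossMoment_eq_zero_comm]
    exact crossMoment_zero_left _
  lift n to Fin κ using hn
  lift l to Fin κ using hl
  rw [← crossMoment_pi_multivariateGaussian_of_ne (fun _ : Fin κ => G.covNoise)
      (fun hnl => h (congrArg _ hnl)),
    ← crossMoment_comp_measurePreserving measurePreserving_stateNoise (measurable_pi_apply n)
      (measurable_pi_apply l), funext (stateNoise_apply n), funext (stateNoise_apply l)]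
  rfl

theorem crossMoment_clm_eq_zero_of_indepFun {d e : ℕ} {f : Sample κ m →L[ℝ] Vec d}
    {g : Sample κ m →L[ℝ] Vec e} (h : IndepFun f g (G.law η)) : crossMoment (G.law η) f g = 0 :=
  crossMoment_eq_zero_of_indepFun h ((memLp_two_clm f).integrable one_le_two)
    (integral_clm_eq_zero (G.integral_law η) f) (memLp_two_clm g).1

theorem crossMoment_free_zero_comp_snd {e : ℕ} (g : (Fin κ → Vec m) × (Fin κ → Vec m) →L[ℝ] Vec e) :
    crossMoment (G.law η) (G.free 0) (g ∘L .snd ℝ _ _ : Sample κ m →L[ℝ] Vec e) = 0 :=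
  crossMoment_clm_eq_zero_of_indepFun (indepFun_prod measurable_id g.continuous.measurable)

theorem crossMoment_free_zero_stateNoise (n : ℕ) :
    crossMoment (G.law η) (G.free 0) (stateNoise n) = 0 := by
  rcases le_or_gt κ n with hn | hn
  · rw [stateNoise_of_le hn, crossMoment_eq_zero_comm]
    exact crossMoment_zero_left _
  · rw [stateNoise, dif_pos hn]
    exact crossMoment_free_zero_comp_snd (.proj (⟨n, hn⟩ : Fin κ) ∘L .fst ℝ _ _)

theorem crossMoment_stateNoise_signalNoise (n : ℕ) (k : Fin κ) :
    crossMoment (G.law η) (stateNoise n) (signalNoise k) = 0 := by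
  rcases le_or_gt κ n with hn | hn
  · rw [stateNoise_of_le hn]
    exact crossMoment_zero_left _
  lift n to Fin κ using hn
  refine crossMoment_clm_eq_zero_of_indepFun ?_
  rw [funext (stateNoise_apply n)]
  exact indepFun_noises.comp (measurable_pi_apply n) (measurable_pi_apply k)

theorem free_succ (n : ℕ) : ⇑(G.free (n + 1)) = matCLM G.A ∘ G.free n + ⇑(stateNoise n) := rfl

theorem crossMoment_free_stateNoise {n l : ℕ} (h : n ≤ l) :
    crossMoment (G.law η) (G.free n) (stateNoise l) = 0 := by
  induction n with
  | zero => exact crossMoment_free_zero_stateNoise l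
  | succ n ih =>
    rw [free_succ, crossMoment_add_left ((matCLM G.A).comp_memLp' (memLp_two_clm _))
        (memLp_two_clm _) (memLp_two_clm _),
      crossMoment_comp_left _ (memLp_two_clm _) (memLp_two_clm _), ih (n.le_succ.trans h), mul_zero,
      zero_add, crossMoment_stateNoise_of_ne (Nat.ne_of_lt h)]

theorem crossMoment_free_signalNoise (n : ℕ) (k : Fin κ) :
    crossMoment (G.law η) (G.free n) (signalNoise k) = 0 := by
  induction n with
  | zero => exact crossMoment_free_zero_comp_snd (.proj k ∘L .snd ℝ _ _)
  | succ n ih =>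
    rw [free_succ, crossMoment_add_left ((matCLM G.A).comp_memLp' (memLp_two_clm _))
        (memLp_two_clm _) (memLp_two_clm _),
      crossMoment_comp_left _ (memLp_two_clm _) (memLp_two_clm _), ih, mul_zero, zero_add,
      crossMoment_stateNoise_signalNoise]

theorem crossMoment_freeSignal_eq_zero {e : ℕ} {f : Sample κ m →L[ℝ] Vec e} {k : Fin κ}
    (hfree : ∀ i ≤ k.val, crossMoment (G.law η) f (G.free i) = 0)
    (hnoise : crossMoment (G.law η) f (signalNoise k) = 0) :
    crossMoment (G.law η) f (G.freeSignal η k) = 0 := by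
  have hsum : ⇑(G.freeSignal η k) =
      ∑ i : Fin (k.val + 1), matCLM (η.gain k i)ᵀ ∘ G.free i + ⇑(signalNoise k) := by
    ext1 z
    simp [freeSignal]
  have hmem (i : Fin (k.val + 1)) : MemLp (matCLM (η.gain k i)ᵀ ∘ G.free i) 2 (G.law η) :=
    (matCLM _).comp_memLp' (memLp_two_clm _)
  rw [hsum, crossMoment_add_right (memLp_two_clm _) (memLp_finsetSum' _ fun i _ => hmem i)
    (memLp_two_clm _), hnoise, add_zero, crossMoment_sum_right _ (memLp_two_clm _) hmem]
  refine Finset.sum_eq_zero fun i _ => ?_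
  rw [crossMoment_comp_right _ (memLp_two_clm _) (memLp_two_clm _),
    hfree i (Nat.lt_succ_iff.1 i.isLt), Matrix.zero_mul]

theorem crossMoment_eq_zero_of_freeSignal {d e n : ℕ} {f : Sample κ m →L[ℝ] Vec d}
    {h : Sample κ m → Vec e}
    (hf : ∀ k : Fin κ, k.val < n → crossMoment (G.law η) f (G.freeSignal η k) = 0)
    (hh : Measurable[G.signalAlgebra η n] h) : crossMoment (G.law η) f h = 0 := by
  have hmeas := (hh.mono (G.signalAlgebra_le η n) le_rfl).aestronglyMeasurable (μ := G.law η)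
  obtain ⟨g, hg, rfl⟩ := hh.exists_eq_measurable_comp
  have hindep := indepFun_of_crossMoment_eq_zero (G.integral_law η) f
    (fun j : {j : Fin κ // j.val < n} => G.freeSignal η j) fun j => hf j j.2
  exact crossMoment_eq_zero_of_indepFun (hindep.comp measurable_id hg)
    ((memLp_two_clm f).integrable one_le_two) (integral_clm_eq_zero (G.integral_law η) f)
    hmeas

theorem crossMoment_stateNoise_eq_zero {e n : ℕ} {h : Sample κ m → Vec e}
    (hh : Measurable[G.signalAlgebra η (n + 1)] h) :
    crossMoment (G.law η) (stateNoise n) h = 0 :=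
  crossMoment_eq_zero_of_freeSignal (fun k hk => crossMoment_freeSignal_eq_zero
    (fun _ hi => crossMoment_eq_zero_comm.1
      (crossMoment_free_stateNoise (hi.trans (Nat.lt_succ_iff.1 hk))))
    (crossMoment_stateNoise_signalNoise n k)) hh

end Game

/-! ### The Riccati recursion -/

namespace Game

section Riccati

variable (G : Game κ m r Ω) (R : Matrix (Fin r) (Fin r) ℝ) (N : Matrix (Fin m) (Fin m) ℝ)

/-- The weight of the input after completion of the square, for the input weight `R` and the weight
`N` of the next state. -/
def inputWeight : Matrix (Fin r) (Fin r) ℝ := R + G.Bᵀ * N * G.B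

/-- The feedback gain of the linear-quadratic regulator. -/
def lqGain : Matrix (Fin r) (Fin m) ℝ := (G.inputWeight R N)⁻¹ * (G.Bᵀ * N * G.A)

/-- One backward step of the Riccati recursion. -/
def riccatiStep : Matrix (Fin m) (Fin m) ℝ :=
  G.Aᵀ * N * G.A - (G.Bᵀ * N * G.A)ᴴ * (G.inputWeight R N)⁻¹ * (G.Bᵀ * N * G.A)

variable {R N}

theorem inputWeight_posDef (hR : R.PosDef) (hN : N.PosSemidef) : (G.inputWeight R N).PosDef :=
  hR.add_posSemidef (by
    simpa only [Matrix.conjTranspose_eq_transpose_of_trivial] using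
      hN.conjTranspose_mul_mul_same G.B)

theorem wsq_next_add_wsq_input (hR : R.PosDef) (hN : N.PosSemidef) (x : Vec m) (u : Vec r) :
    wsq N (matCLM G.A x + matCLM G.B u) + wsq R u =
      wsq (G.inputWeight R N) (u + matCLM (G.lqGain R N) x) + wsq (G.riccatiStep R N) x := by
  have hweight := G.inputWeight_posDef hR hN
  have : Invertible (G.inputWeight R N) := hweight.isUnit.invertible
  have hNt : Nᵀ = N := (Matrix.isHermitian_iff_isSymm.1 hN.isHermitian).eq
  have hschur := Matrix.schur_complement_eq₁₁ (G.Bᵀ * N * G.A) (G.Aᵀ * N * G.A) u.ofLp x.ofLp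
    hweight.isHermitian
  simp only [star_trivial, ← Matrix.dotProduct_mulVec] at hschur
  refine Eq.trans ?_ hschur
  simp only [wsq, inputWeight, Matrix.dotProduct_mulVec, Matrix.vecMul_fromBlocks, ofLp_matCLM,
    WithLp.ofLp_add, Matrix.add_vecMul, Matrix.vecMul_add, Matrix.vecMul_mulVec,
    Matrix.vecMul_vecMul, add_dotProduct, dotProduct_add,
    Matrix.conjTranspose_eq_transpose_of_trivial, Matrix.transpose_mul, Matrix.transpose_transpose,
    hNt, sumElim_dotProduct_sumElim, Sum.elim_comp_inl, Sum.elim_comp_inr, Matrix.mul_assoc]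
  ring

theorem integral_wsq_next_add_wsq_input {S : Type*} {_ : MeasurableSpace S} {μ : Measure S}
    (hR : R.PosDef) (hN : N.PosSemidef) {x : S → Vec m} {u : S → Vec r} (hx : MemLp x 2 μ)
    (hu : MemLp u 2 μ) :
    ∫ z, wsq N (matCLM G.A (x z) + matCLM G.B (u z)) ∂μ + ∫ z, wsq R (u z) ∂μ =
      ∫ z, wsq (G.inputWeight R N) (u z + matCLM (G.lqGain R N) (x z)) ∂μ +
        ∫ z, wsq (G.riccatiStep R N) (x z) ∂μ := by
  have hnext := ((matCLM G.A).comp_memLp' hx).add ((matCLM G.B).comp_memLp' hu)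
  have hdev := hu.add ((matCLM (G.lqGain R N)).comp_memLp' hx)
  exact (integral_add (integrable_wsq N hnext) (integrable_wsq R hu)).symm.trans
    ((integral_congr_ae (.of_forall fun z => G.wsq_next_add_wsq_input hR hN (x z) (u z))).trans
      (integral_add (integrable_wsq _ hdev) (integrable_wsq _ hx)))

theorem riccatiStep_posSemidef (hR : R.PosDef) (hN : N.PosSemidef) :
    (G.riccatiStep R N).PosSemidef := by
  refine .of_dotProduct_mulVec_nonneg ?_ fun x => ?_
  · have hAN : (G.Aᵀ * N * G.A).IsHermitian := by
      simpa only [Matrix.conjTranspose_eq_transpose_of_trivial] using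
        (hN.conjTranspose_mul_mul_same G.A).isHermitian
    exact hAN.sub (Matrix.isHermitian_conjTranspose_mul_mul _
      (G.inputWeight_posDef hR hN).isHermitian.inv)
  · have hmin := G.wsq_next_add_wsq_input hR hN (WithLp.toLp 2 x)
      (-matCLM (G.lqGain R N) (WithLp.toLp 2 x))
    have hzero : wsq (G.inputWeight R N) 0 = 0 := by simp [wsq]
    rw [neg_add_cancel, hzero, zero_add] at hmin
    rw [star_trivial]
    exact (add_nonneg (wsq_nonneg hN _) (wsq_nonneg hR.posSemidef _)).trans_eq hmin

end Riccati

section StageMatrices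

variable (G : Game κ m r Ω) (ω : Option Ω)

/-- The weight of the state in the optimal cost to go of the type-`ω` follower, indexed by the
number of remaining stages. -/
def riccati : ℕ → Matrix (Fin m) (Fin m) ℝ
  | 0 => 0
  | j + 1 => G.riccatiStep (G.R ω) (G.Q ω + riccati j)

/-- The weight at stage `n` of the next state, including its cost to go. -/
def stateWeight (n : ℕ) : Matrix (Fin m) (Fin m) ℝ := G.Q ω + G.riccati ω (κ - (n + 1))

/-- The weight at stage `n` of the deviation from the optimal feedback. -/
def stageWeight (n : ℕ) : Matrix (Fin r) (Fin r) ℝ := G.inputWeight (G.R ω) (G.stateWeight ω n)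

/-- The optimal feedback gain at stage `n`. -/
def stageGain (n : ℕ) : Matrix (Fin r) (Fin m) ℝ := G.lqGain (G.R ω) (G.stateWeight ω n)

variable {G ω}

theorem riccati_posSemidef (hQ : (G.Q ω).PosSemidef) (hR : (G.R ω).PosDef) (j : ℕ) :
    (G.riccati ω j).PosSemidef := by
  induction j with
  | zero => exact .zero
  | succ j ih => exact G.riccatiStep_posSemidef hR (hQ.add ih)

theorem stateWeight_posSemidef (hQ : (G.Q ω).PosSemidef) (hR : (G.R ω).PosDef) (n : ℕ) :
    (G.stateWeight ω n).PosSemidef :=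
  hQ.add (riccati_posSemidef hQ hR _)

theorem stageWeight_posDef (hQ : (G.Q ω).PosSemidef) (hR : (G.R ω).PosDef) (n : ℕ) :
    (G.stageWeight ω n).PosDef :=
  G.inputWeight_posDef hR (stateWeight_posSemidef hQ hR n)

theorem riccati_sub_of_lt {n : ℕ} (h : n < κ) :
    G.riccati ω (κ - n) = G.riccatiStep (G.R ω) (G.stateWeight ω n) := by
  rw [stateWeight, ← riccati]
  congr 1
  omega

end StageMatrices

end Game

/-! ### The cost of the follower by completion of squares -/

namespace Game

variable (G : Game κ m r Ω) (η : SignalingRule κ m) (ω : Option Ω)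

/-- Square-integrable inputs, each a function of the signals up to its stage. The stages beyond the
horizon are included to avoid side conditions. -/
structure IsAdmissible (u : ℕ → Sample κ m → Vec r) : Prop where
  measurable : ∀ n, Measurable[G.signalAlgebra η (n + 1)] (u n)
  memLp : ∀ n, MemLp (u n) 2 (G.law η)

/-- The state generated by the inputs `u`. -/
def path (u : ℕ → Sample κ m → Vec r) (n : ℕ) (z : Sample κ m) : Vec m :=
  G.free n z + G.driven (u · z) n

/-- The conditional expectation of the control-free state given the signals up to the current
stage. -/
def estimate (n : ℕ) : Sample κ m → Vec m :=
  (G.law η)[G.free n | G.signalAlgebra η (n + 1)]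

/-- The deviation of the inputs `u` from the optimal feedback of the estimated state. -/
def deviation (u : ℕ → Sample κ m → Vec r) (n : ℕ) (z : Sample κ m) : Vec r :=
  u n z + matCLM (G.stageGain ω n) (G.estimate η n z + G.driven (u · z) n)

theorem measurable_estimate (n : ℕ) : Measurable[G.signalAlgebra η (n + 1)] (G.estimate η n) :=
  stronglyMeasurable_condExp.measurable

theorem memLp_estimate (n : ℕ) : MemLp (G.estimate η n) 2 (G.law η) :=
  (memLp_two_clm (G.free n)).condExp one_le_two

theorem memLp_free_sub_estimate (n : ℕ) : MemLp (⇑(G.free n) - G.estimate η n) 2 (G.law η) :=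
  (memLp_two_clm (G.free n)).sub (G.memLp_estimate η n)

variable {G η ω}

theorem crossMoment_free_sub_estimate {e n : ℕ} {h : Sample κ m → Vec e}
    (hh : Measurable[G.signalAlgebra η (n + 1)] h) (hh2 : MemLp h 2 (G.law η)) :
    crossMoment (G.law η) (⇑(G.free n) - G.estimate η n) h = 0 :=
  crossMoment_sub_condExp_eq_zero (G.signalAlgebra_le η _) (memLp_two_clm _) hh hh2

theorem path_succ (u : ℕ → Sample κ m → Vec r) (n : ℕ) :
    G.path u (n + 1) = (matCLM G.A ∘ G.path u n + matCLM G.B ∘ u n) + ⇑(stateNoise n) := by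
  ext1 z
  simp only [path, free, driven, map_add, Pi.add_apply, Function.comp_apply, _root_.add_apply,
    ContinuousLinearMap.comp_apply]
  abel

theorem memLp_driven {S : Type*} {_ : MeasurableSpace S} {μ : Measure S} {u : ℕ → S → Vec r}
    (hu : ∀ n, MemLp (u n) 2 μ) (n : ℕ) : MemLp (fun z => G.driven (u · z) n) 2 μ := by
  induction n with
  | zero => exact MemLp.zero
  | succ n ih => exact ((matCLM G.A).comp_memLp' ih).add ((matCLM G.B).comp_memLp' (hu n))

namespace IsAdmissible

variable {u : ℕ → Sample κ m → Vec r}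

theorem measurable_driven (hu : G.IsAdmissible η u) (n : ℕ) :
    Measurable[G.signalAlgebra η (n + 1)] fun z => G.driven (u · z) n :=
  G.measurable_driven fun i hi =>
    (hu.measurable i).mono (G.signalAlgebra_mono η (by omega)) le_rfl

theorem memLp_path (hu : G.IsAdmissible η u) (n : ℕ) : MemLp (G.path u n) 2 (G.law η) :=
  (memLp_two_clm _).add (memLp_driven hu.memLp n)

theorem measurable_deviation (hu : G.IsAdmissible η u) (n : ℕ) :
    Measurable[G.signalAlgebra η (n + 1)] (G.deviation η ω u n) :=
  (hu.measurable n).add ((matCLM _).continuous.measurable.comp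
    ((G.measurable_estimate η n).add (hu.measurable_driven n)))

theorem memLp_deviation (hu : G.IsAdmissible η u) (n : ℕ) :
    MemLp (G.deviation η ω u n) 2 (G.law η) :=
  (hu.memLp n).add
    ((matCLM _).comp_memLp' ((G.memLp_estimate η n).add (memLp_driven hu.memLp n)))

theorem crossMoment_next_stateNoise (hu : G.IsAdmissible η u) (n : ℕ) :
    crossMoment (G.law η) (matCLM G.A ∘ G.path u n + matCLM G.B ∘ u n) (stateNoise n) = 0 := by
  have hw : MemLp (stateNoise n) 2 (G.law η) := memLp_two_clm _
  have hfree : crossMoment (G.law η) (G.free n) (stateNoise n) = 0 :=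
    crossMoment_free_stateNoise le_rfl
  have hdriven :=
    crossMoment_eq_zero_comm.1 (crossMoment_stateNoise_eq_zero (hu.measurable_driven n))
  have hinput := crossMoment_eq_zero_comm.1 (crossMoment_stateNoise_eq_zero (hu.measurable n))
  have hpath : crossMoment (G.law η) (G.path u n) (stateNoise n) = 0 := by
    refine (crossMoment_add_left (memLp_two_clm _) (memLp_driven hu.memLp n) hw).trans ?_
    rw [hfree, hdriven, add_zero]
  rw [crossMoment_add_left ((matCLM _).comp_memLp' (hu.memLp_path n))
      ((matCLM _).comp_memLp' (hu.memLp n)) hw, crossMoment_comp_left _ (hu.memLp_path n) hw,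
    crossMoment_comp_left _ (hu.memLp n) hw, hpath, hinput, Matrix.mul_zero,
    Matrix.mul_zero, add_zero]

theorem integral_wsq_input_add_gain (hu : G.IsAdmissible η u) (W : Matrix (Fin r) (Fin r) ℝ)
    (n : ℕ) :
    ∫ z, wsq W (u n z + matCLM (G.stageGain ω n) (G.path u n z)) ∂(G.law η) =
      ∫ z, wsq W (matCLM (G.stageGain ω n) (G.free n z - G.estimate η n z)) ∂(G.law η) +
        ∫ z, wsq W (G.deviation η ω u n z) ∂(G.law η) := by
  have herr := G.memLp_free_sub_estimate η n
  have hdev := hu.memLp_deviation (ω := ω) n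
  have hsplit (z : Sample κ m) : u n z + matCLM (G.stageGain ω n) (G.path u n z) =
      matCLM (G.stageGain ω n) (G.free n z - G.estimate η n z) + G.deviation η ω u n z := by
    simp only [deviation, path, map_add, map_sub]
    abel
  simp only [hsplit]
  refine integral_wsq_add W ((matCLM (G.stageGain ω n)).comp_memLp' herr) hdev ?_
  refine (crossMoment_comp_left _ herr hdev).trans ?_
  rw [crossMoment_free_sub_estimate (hu.measurable_deviation n) hdev, Matrix.mul_zero]

end IsAdmissible

/-- The part of the expected cost of stage `n` that no policy can influence. -/
def stageBase (G : Game κ m r Ω) (η : SignalingRule κ m) (ω : Option Ω) (n : ℕ) : ℝ :=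
  ∫ z, wsq (G.stateWeight ω n) (stateNoise n z) ∂(G.law η) +
    ∫ z, wsq (G.stageWeight ω n) (matCLM (G.stageGain ω n) (G.free n z - G.estimate η n z))
      ∂(G.law η)

/-- The infimum of the objective of the type-`ω` follower. -/
def baseCost (G : Game κ m r Ω) (η : SignalingRule κ m) (ω : Option Ω) : ℝ :=
  ∫ z, wsq (G.riccati ω κ) (G.free 0 z) ∂(G.law η) + ∑ n ∈ Finset.range κ, G.stageBase η ω n

theorem baseCost_nonneg (hQ : (G.Q ω).PosSemidef) (hR : (G.R ω).PosDef) :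
    0 ≤ G.baseCost η ω :=
  add_nonneg (integral_wsq_nonneg (riccati_posSemidef hQ hR _) _)
    (Finset.sum_nonneg fun n _ => add_nonneg
      (integral_wsq_nonneg (stateWeight_posSemidef hQ hR n) _)
      (integral_wsq_nonneg (stageWeight_posDef hQ hR n).posSemidef _))

namespace IsAdmissible

variable {u : ℕ → Sample κ m → Vec r}

theorem integral_stage (hu : G.IsAdmissible η u) (hQ : (G.Q ω).PosSemidef) (hR : (G.R ω).PosDef)
    (n : ℕ) :
    ∫ z, wsq (G.stateWeight ω n) (G.path u (n + 1) z) ∂(G.law η)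
        + ∫ z, wsq (G.R ω) (u n z) ∂(G.law η) =
      ∫ z, wsq (G.riccatiStep (G.R ω) (G.stateWeight ω n)) (G.path u n z) ∂(G.law η)
        + (G.stageBase η ω n
          + ∫ z, wsq (G.stageWeight ω n) (G.deviation η ω u n z) ∂(G.law η)) := by
  have hnoise := integral_wsq_add (G.stateWeight ω n)
    (((matCLM G.A).comp_memLp' (hu.memLp_path n)).add ((matCLM G.B).comp_memLp' (hu.memLp n)))
    (memLp_two_clm (stateNoise n)) (hu.crossMoment_next_stateNoise n)
  have hsquare := G.integral_wsq_next_add_wsq_input hR (stateWeight_posSemidef hQ hR n)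
    (hu.memLp_path n) (hu.memLp n)
  have hdev := hu.integral_wsq_input_add_gain (ω := ω) (G.stageWeight ω n) n
  simp only [path_succ]
  simp only [stageBase, stageWeight, stageGain, Pi.add_apply, Function.comp_apply] at *
  linarith

theorem sum_cost_add_costToGo (hu : G.IsAdmissible η u) (hQ : (G.Q ω).PosSemidef)
    (hR : (G.R ω).PosDef) {N : ℕ} (hN : N ≤ κ) :
    ∑ n ∈ Finset.range N, (∫ z, wsq (G.Q ω) (G.path u (n + 1) z) ∂(G.law η)
        + ∫ z, wsq (G.R ω) (u n z) ∂(G.law η))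
      + ∫ z, wsq (G.riccati ω (κ - N)) (G.path u N z) ∂(G.law η) =
    ∫ z, wsq (G.riccati ω κ) (G.free 0 z) ∂(G.law η) +
      ∑ n ∈ Finset.range N, (G.stageBase η ω n +
        ∫ z, wsq (G.stageWeight ω n) (G.deviation η ω u n z) ∂(G.law η)) := by
  induction N with
  | zero => simp [path, driven]
  | succ N ih =>
    have hprev := ih (N.le_succ.trans hN)
    have hstage := hu.integral_stage hQ hR N
    have hsplit : ∫ z, wsq (G.stateWeight ω N) (G.path u (N + 1) z) ∂(G.law η) =
        ∫ z, wsq (G.Q ω) (G.path u (N + 1) z) ∂(G.law η) +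
          ∫ z, wsq (G.riccati ω (κ - (N + 1))) (G.path u (N + 1) z) ∂(G.law η) := by
      rw [← integral_add (integrable_wsq _ (hu.memLp_path _)) (integrable_wsq _ (hu.memLp_path _))]
      simp only [stateWeight, wsq, Matrix.add_mulVec, dotProduct_add]
    rw [riccati_sub_of_lt hN] at hprev
    rw [Finset.sum_range_succ, Finset.sum_range_succ]
    linarith

theorem sum_cost_eq (hu : G.IsAdmissible η u) (hQ : (G.Q ω).PosSemidef) (hR : (G.R ω).PosDef) :
    ∑ n ∈ Finset.range κ, (∫ z, wsq (G.Q ω) (G.path u (n + 1) z) ∂(G.law η)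
        + ∫ z, wsq (G.R ω) (u n z) ∂(G.law η)) = G.baseCost η ω +
      ∑ n ∈ Finset.range κ, ∫ z, wsq (G.stageWeight ω n) (G.deviation η ω u n z) ∂(G.law η) := by
  have hsum := hu.sum_cost_add_costToGo hQ hR le_rfl
  have hzero : ∫ z, wsq (0 : Matrix (Fin m) (Fin m) ℝ) (G.path u κ z) ∂(G.law η) = 0 := by
    simp [wsq]
  rw [Nat.sub_self, riccati, hzero, add_zero] at hsum
  rw [hsum, baseCost, add_assoc, ← Finset.sum_add_distrib]

end IsAdmissible

theorem stateCost_eq_sum (W : Matrix (Fin m) (Fin m) ℝ) (γ : ControlPolicy κ m r) :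
    G.stateCost W η γ = ∑ n ∈ Finset.range κ,
      ∫⁻ z, ENNReal.ofReal (wsq W (G.path (fun n z => G.input η γ z n) (n + 1) z)) ∂(G.law η) := by
  rw [← Fin.sum_univ_eq_sum_range fun n =>
    ∫⁻ z, ENNReal.ofReal (wsq W (G.path (fun n z => G.input η γ z n) (n + 1) z)) ∂(G.law η)]
  simp only [stateCost, state_eq, path]

theorem controlCost_eq_sum (W : Matrix (Fin r) (Fin r) ℝ) (γ : ControlPolicy κ m r) :
    G.controlCost W η γ =
      ∑ n ∈ Finset.range κ, ∫⁻ z, ENNReal.ofReal (wsq W (G.input η γ z n)) ∂(G.law η) := by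
  rw [← Fin.sum_univ_eq_sum_range fun n =>
    ∫⁻ z, ENNReal.ofReal (wsq W (G.input η γ z n)) ∂(G.law η)]
  simp only [controlCost, input_coe]

theorem isAdmissible_input (hR : (G.R ω).PosDef) {γ : ControlPolicy κ m r}
    (h : G.followerCost ω η γ ≠ ∞) : G.IsAdmissible η fun n z => G.input η γ z n where
  measurable n := G.measurable_input η γ n
  memLp n := by
    by_cases hn : n < κ
    · have hcost : G.controlCost (G.R ω) η γ ≠ ∞ := (ENNReal.add_ne_top.1 h).2
      rw [controlCost_eq_sum, ENNReal.sum_ne_top] at hcost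
      exact memLp_two_of_lintegral_wsq_ne_top hR
        ((G.measurable_input η γ n).mono (G.signalAlgebra_le η _) le_rfl)
        (hcost n (Finset.mem_range.2 hn))
    · simp only [input, hn, dif_neg, not_false_eq_true]
      exact MemLp.zero

theorem followerCost_eq (hQ : (G.Q ω).PosSemidef) (hR : (G.R ω).PosDef) {γ : ControlPolicy κ m r}
    (hu : G.IsAdmissible η fun n z => G.input η γ z n) :
    G.followerCost ω η γ = ENNReal.ofReal (G.baseCost η ω + ∑ n ∈ Finset.range κ,
      ∫ z, wsq (G.stageWeight ω n) (G.deviation η ω (fun n z => G.input η γ z n) n z)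
        ∂(G.law η)) := by
  rw [← hu.sum_cost_eq hQ hR, ENNReal.ofReal_sum_of_nonneg fun n _ =>
    add_nonneg (integral_wsq_nonneg hQ _) (integral_wsq_nonneg hR.posSemidef _), followerCost,
    stateCost_eq_sum, controlCost_eq_sum, ← Finset.sum_add_distrib]
  refine Finset.sum_congr rfl fun n _ => ?_
  rw [ENNReal.ofReal_add (integral_wsq_nonneg hQ _) (integral_wsq_nonneg hR.posSemidef _),
    lintegral_wsq hQ (hu.memLp_path _), lintegral_wsq hR.posSemidef (hu.memLp n)]

end Game

/-! ### Best responses -/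

namespace Game

variable (G : Game κ m r Ω) (η : SignalingRule κ m) (ω : Option Ω)

/-- The innovations of the estimates of the control-free state. -/
def innovation : ℕ → Sample κ m → Vec m
  | 0 => G.estimate η 0
  | n + 1 => G.estimate η (n + 1) - matCLM G.A ∘ G.estimate η n

/-- The conditional expectation of the state under the optimal feedback of the type-`ω` follower,
given by the Kalman filter. -/
def filtered : ℕ → Sample κ m → Vec m
  | 0 => G.innovation η 0
  | n + 1 => matCLM (G.A - G.B * G.stageGain ω n) ∘ filtered n + G.innovation η (n + 1)

/-- The optimal inputs of the type-`ω` follower. -/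
def optInput (n : ℕ) : Sample κ m → Vec r :=
  matCLM (-G.stageGain ω n) ∘ G.filtered η ω n

theorem driven_optInput (n : ℕ) (z : Sample κ m) :
    G.driven (G.optInput η ω · z) n = G.filtered η ω n z - G.estimate η n z := by
  induction n with
  | zero => simp [driven, filtered, innovation]
  | succ n ih =>
    rw [driven, ih]
    simp only [filtered, innovation, optInput, Pi.add_apply, Pi.sub_apply, Function.comp_apply,
      map_sub, map_neg, _root_.sub_apply, _root_.neg_apply, matCLM_mul_apply]
    abel

theorem deviation_optInput (n : ℕ) (z : Sample κ m) :
    G.deviation η ω (G.optInput η ω) n z = 0 := by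
  rw [deviation, driven_optInput, add_sub_cancel, optInput, Function.comp_apply, map_neg,
    _root_.neg_apply, neg_add_cancel]

theorem path_optInput (n : ℕ) :
    G.path (G.optInput η ω) n = (⇑(G.free n) - G.estimate η n) + G.filtered η ω n := by
  ext1 z
  rw [path, driven_optInput, Pi.add_apply, Pi.sub_apply]
  abel

theorem measurable_innovation (n : ℕ) :
    Measurable[G.signalAlgebra η (n + 1)] (G.innovation η n) := by
  cases n with
  | zero => exact G.measurable_estimate η 0
  | succ n =>
    exact (G.measurable_estimate η (n + 1)).sub ((matCLM _).continuous.measurable.comp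
      ((G.measurable_estimate η n).mono (G.signalAlgebra_mono η (n + 1).le_succ) le_rfl))

theorem memLp_innovation (n : ℕ) : MemLp (G.innovation η n) 2 (G.law η) := by
  cases n with
  | zero => exact G.memLp_estimate η 0
  | succ n => exact (G.memLp_estimate η _).sub ((matCLM _).comp_memLp' (G.memLp_estimate η n))

theorem measurable_filtered (n : ℕ) :
    Measurable[G.signalAlgebra η (n + 1)] (G.filtered η ω n) := by
  induction n with
  | zero => exact G.measurable_innovation η 0
  | succ n ih =>
    exact ((matCLM _).continuous.measurable.comp
      (ih.mono (G.signalAlgebra_mono η (n + 1).le_succ) le_rfl)).add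
        (G.measurable_innovation η (n + 1))

theorem memLp_filtered (n : ℕ) : MemLp (G.filtered η ω n) 2 (G.law η) := by
  induction n with
  | zero => exact G.memLp_innovation η 0
  | succ n ih => exact ((matCLM _).comp_memLp' ih).add (G.memLp_innovation η (n + 1))

theorem isAdmissible_optInput : G.IsAdmissible η (G.optInput η ω) where
  measurable n := (matCLM _).continuous.measurable.comp (G.measurable_filtered η ω n)
  memLp n := (matCLM _).comp_memLp' (G.memLp_filtered η ω n)

theorem exists_policy_optInput :
    ∃ γ : ControlPolicy κ m r, ∀ z, ∀ n < κ, G.input η γ z n = G.optInput η ω n z :=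
  G.exists_policy η (G.isAdmissible_optInput η ω).measurable

variable {G η ω} {γ : ControlPolicy κ m r}

theorem baseCost_le_followerCost (hQ : (G.Q ω).PosSemidef) (hR : (G.R ω).PosDef) :
    ENNReal.ofReal (G.baseCost η ω) ≤ G.followerCost ω η γ := by
  by_cases htop : G.followerCost ω η γ = ∞
  · exact htop ▸ le_top
  · rw [followerCost_eq hQ hR (isAdmissible_input hR htop)]
    exact ENNReal.ofReal_le_ofReal (le_add_of_nonneg_right (Finset.sum_nonneg fun n _ =>
      integral_wsq_nonneg (stageWeight_posDef hQ hR n).posSemidef _))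

theorem followerCost_of_input_eq (hQ : (G.Q ω).PosSemidef) (hR : (G.R ω).PosDef)
    (h : ∀ z, ∀ n < κ, G.input η γ z n = G.optInput η ω n z) :
    G.followerCost ω η γ = ENNReal.ofReal (G.baseCost η ω) := by
  have hadm : G.IsAdmissible η fun n z => G.input η γ z n :=
    { measurable := G.measurable_input η γ
      memLp := fun n => by
        by_cases hn : n < κ
        · simpa only [h _ n hn] using (G.isAdmissible_optInput η ω).memLp n
        · simp only [input, hn, dif_neg, not_false_eq_true]
          exact MemLp.zero }
  rw [followerCost_eq hQ hR hadm, Finset.sum_eq_zero, add_zero]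
  intro n hn
  have hdev (z : Sample κ m) : G.deviation η ω (fun n z => G.input η γ z n) n z = 0 := by
    have hn := Finset.mem_range.1 hn
    rw [← G.deviation_optInput η ω n z, deviation, deviation, h z n hn,
      G.driven_congr fun i hi => h z i (hi.trans hn)]
  simp [hdev, wsq]

theorem isBestResponse_iff (hQ : (G.Q ω).PosSemidef) (hR : (G.R ω).PosDef) :
    G.IsBestResponse ω η γ ↔ G.followerCost ω η γ = ENNReal.ofReal (G.baseCost η ω) := by
  obtain ⟨γ', hγ'⟩ := G.exists_policy_optInput η ω
  refine ⟨fun hγ => le_antisymm ?_ (baseCost_le_followerCost hQ hR), fun hγ γ' => ?_⟩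
  · exact (hγ γ').trans_eq (followerCost_of_input_eq hQ hR hγ')
  · exact hγ.trans_le (baseCost_le_followerCost hQ hR)

theorem exists_isBestResponse (hQ : (G.Q ω).PosSemidef) (hR : (G.R ω).PosDef) :
    ∃ γ : ControlPolicy κ m r, G.IsBestResponse ω η γ := by
  obtain ⟨γ, hγ⟩ := G.exists_policy_optInput η ω
  exact ⟨γ, (isBestResponse_iff hQ hR).2 (followerCost_of_input_eq hQ hR hγ)⟩

namespace IsBestResponse

theorem deviation_ae_eq_zero (hγ : G.IsBestResponse ω η γ) (hQ : (G.Q ω).PosSemidef)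
    (hR : (G.R ω).PosDef) {n : ℕ} (hn : n < κ) :
    ∀ᵐ z ∂(G.law η), G.deviation η ω (fun n z => G.input η γ z n) n z = 0 := by
  have hcost := (isBestResponse_iff hQ hR).1 hγ
  have hadm := isAdmissible_input hR (hcost.trans_ne ENNReal.ofReal_ne_top)
  have hnonneg (n : ℕ) := integral_wsq_nonneg (stageWeight_posDef hQ hR n).posSemidef
    (μ := G.law η) (G.deviation η ω (fun n z => G.input η γ z n) n)
  have hbase := baseCost_nonneg (η := η) hQ hR
  rw [followerCost_eq hQ hR hadm, ENNReal.ofReal_eq_ofReal_iff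
    (add_nonneg hbase (Finset.sum_nonneg fun n _ => hnonneg n)) hbase, add_eq_left,
    Finset.sum_eq_zero_iff_of_nonneg fun n _ => hnonneg n] at hcost
  exact ae_eq_zero_of_integral_wsq_eq_zero (stageWeight_posDef hQ hR n) (hadm.memLp_deviation n)
    (hcost n (Finset.mem_range.2 hn))

theorem input_ae_eq (hγ : G.IsBestResponse ω η γ) (hQ : (G.Q ω).PosSemidef)
    (hR : (G.R ω).PosDef) :
    ∀ᵐ z ∂(G.law η), ∀ n < κ, G.input η γ z n = G.optInput η ω n z := by
  have hdev : ∀ᵐ z ∂(G.law η), ∀ n : Fin κ,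
      G.deviation η ω (fun n z => G.input η γ z n) n z = 0 :=
    ae_all_iff.2 fun n => hγ.deviation_ae_eq_zero hQ hR n.isLt
  filter_upwards [hdev] with z hz n hn
  induction n using Nat.strong_induction_on with
  | _ n ih =>
    have hin := hz ⟨n, hn⟩
    have hopt := G.deviation_optInput η ω n z
    rw [deviation] at hin hopt
    rw [G.driven_congr fun i hi => ih i hi (hi.trans hn)] at hin
    exact add_right_cancel (hin.trans hopt.symm)

theorem stateCost_eq (hγ : G.IsBestResponse ω η γ) (hQ : (G.Q ω).PosSemidef)
    (hR : (G.R ω).PosDef) {W : Matrix (Fin m) (Fin m) ℝ} (hW : W.PosSemidef) :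
    G.stateCost W η γ = ∑ n ∈ Finset.range κ,
      ENNReal.ofReal (∫ z, wsq W (G.path (G.optInput η ω) (n + 1) z) ∂(G.law η)) := by
  rw [stateCost_eq_sum]
  refine Finset.sum_congr rfl fun n hn => ?_
  rw [← lintegral_wsq hW ((G.isAdmissible_optInput η ω).memLp_path _)]
  refine lintegral_congr_ae ?_
  filter_upwards [hγ.input_ae_eq hQ hR] with z hz
  rw [path, path, G.driven_congr fun i hi => hz i (hi.trans_le (Finset.mem_range.1 hn))]

theorem controlCost_eq (hγ : G.IsBestResponse ω η γ) (hQ : (G.Q ω).PosSemidef)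
    (hR : (G.R ω).PosDef) {W : Matrix (Fin r) (Fin r) ℝ} (hW : W.PosSemidef) :
    G.controlCost W η γ = ∑ n ∈ Finset.range κ,
      ENNReal.ofReal (∫ z, wsq W (G.optInput η ω n z) ∂(G.law η)) := by
  rw [controlCost_eq_sum]
  refine Finset.sum_congr rfl fun n hn => ?_
  rw [← lintegral_wsq hW ((G.isAdmissible_optInput η ω).memLp n)]
  refine lintegral_congr_ae ?_
  filter_upwards [hγ.input_ae_eq hQ hR] with z hz
  rw [hz n (Finset.mem_range.1 hn)]

end IsBestResponse

end Game

/-! ### Second moments under best responses -/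

namespace Game

section Covariances

variable (G : Game κ m r Ω) (ω : Option Ω) (H : ℕ → Matrix (Fin m) (Fin m) ℝ)

/-- The covariance of the zero-padded state noise. -/
def stateNoiseCov (n : ℕ) : Matrix (Fin m) (Fin m) ℝ := if n < κ then G.covNoise else 0

/-- The covariance of the control-free state. -/
def freeCov : ℕ → Matrix (Fin m) (Fin m) ℝ
  | 0 => G.covInit
  | n + 1 => G.A * freeCov n * G.Aᵀ + G.stateNoiseCov n

/-- The covariance of the one-step prediction of the control-free state, from the covariances `H`
of its estimates. -/
def priorCov : ℕ → Matrix (Fin m) (Fin m) ℝ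
  | 0 => 0
  | n + 1 => G.A * H n * G.Aᵀ

/-- The second moment of the one-step prediction of the state under the optimal inputs, from the
covariances `H` of the estimates of the control-free state. -/
def predictedMoment : ℕ → Matrix (Fin m) (Fin m) ℝ
  | 0 => 0
  | n + 1 => (G.A - G.B * G.stageGain ω n) * (predictedMoment n + (H n - G.priorCov H n)) *
      (G.A - G.B * G.stageGain ω n)ᵀ

/-- The second moment of the state under the optimal inputs, from the covariances `H`. -/
def pathMoment (n : ℕ) : Matrix (Fin m) (Fin m) ℝ :=
  G.freeCov n - G.priorCov H n + G.predictedMoment ω H n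

/-- The second moment of the optimal inputs, from the covariances `H`. -/
def inputMoment (n : ℕ) : Matrix (Fin r) (Fin r) ℝ :=
  G.stageGain ω n * (G.predictedMoment ω H n + (H n - G.priorCov H n)) * (G.stageGain ω n)ᵀ

theorem continuous_priorCov (n : ℕ) : Continuous fun H => G.priorCov H n := by
  cases n <;> simp only [priorCov] <;> fun_prop

theorem continuous_predictedMoment (n : ℕ) : Continuous fun H => G.predictedMoment ω H n := by
  induction n with
  | zero => exact continuous_const
  | succ n ih =>
    have := G.continuous_priorCov n
    simp only [predictedMoment]
    fun_prop

theorem continuous_pathMoment (n : ℕ) : Continuous fun H => G.pathMoment ω H n :=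
  (continuous_const.sub (G.continuous_priorCov n)).add (G.continuous_predictedMoment ω n)

theorem continuous_inputMoment (n : ℕ) : Continuous fun H => G.inputMoment ω H n := by
  have := G.continuous_priorCov n
  have := G.continuous_predictedMoment ω n
  unfold inputMoment
  fun_prop

variable {H} {H' : ℕ → Matrix (Fin m) (Fin m) ℝ} {n : ℕ}

theorem priorCov_congr (h : ∀ i < n, H i = H' i) : G.priorCov H n = G.priorCov H' n := by
  cases n with
  | zero => rfl
  | succ n => rw [priorCov, priorCov, h n n.lt_succ_self]

theorem predictedMoment_congr (h : ∀ i < n, H i = H' i) :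
    G.predictedMoment ω H n = G.predictedMoment ω H' n := by
  induction n with
  | zero => rfl
  | succ n ih =>
    have hlt : ∀ i < n, H i = H' i := fun i hi => h i (hi.trans n.lt_succ_self)
    rw [predictedMoment, predictedMoment, ih hlt, G.priorCov_congr hlt, h n n.lt_succ_self]

theorem pathMoment_congr (h : ∀ i < n, H i = H' i) : G.pathMoment ω H n = G.pathMoment ω H' n := by
  rw [pathMoment, pathMoment, G.priorCov_congr h, G.predictedMoment_congr ω h]

theorem inputMoment_congr (h : ∀ i ≤ n, H i = H' i) :
    G.inputMoment ω H n = G.inputMoment ω H' n := by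
  have hlt : ∀ i < n, H i = H' i := fun i hi => h i hi.le
  rw [inputMoment, inputMoment, G.priorCov_congr hlt, G.predictedMoment_congr ω hlt, h n le_rfl]

end Covariances

/-- The second moment of the estimate of the control-free state. -/
def estimateCov (G : Game κ m r Ω) (η : SignalingRule κ m) (n : ℕ) : Matrix (Fin m) (Fin m) ℝ :=
  crossMoment (G.law η) (G.estimate η n) (G.estimate η n)

variable {G : Game κ m r Ω} {η : SignalingRule κ m} {ω : Option Ω}

theorem crossMoment_stateNoise_self_eq_stateNoiseCov (hNoise : G.covNoise.PosSemidef) (n : ℕ) :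
    crossMoment (G.law η) (stateNoise n) (stateNoise n) = G.stateNoiseCov n := by
  by_cases hn : n < κ
  · rw [stateNoiseCov, if_pos hn]
    exact crossMoment_stateNoise_self hNoise ⟨n, hn⟩
  · rw [stateNoiseCov, if_neg hn, stateNoise_of_le (not_lt.1 hn)]
    exact crossMoment_zero_left _

theorem crossMoment_free_self (hInit : G.covInit.PosSemidef) (hNoise : G.covNoise.PosSemidef)
    (n : ℕ) : crossMoment (G.law η) (G.free n) (G.free n) = G.freeCov n := by
  induction n with
  | zero => exact crossMoment_free_zero_self hInit
  | succ n ih =>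
    have hx : MemLp (G.free n) 2 (G.law η) := memLp_two_clm _
    have hw : MemLp (stateNoise n) 2 (G.law η) := memLp_two_clm _
    have hcross : crossMoment (G.law η) (matCLM G.A ∘ G.free n) (stateNoise n) = 0 := by
      refine (crossMoment_comp_left _ hx hw).trans ?_
      rw [crossMoment_free_stateNoise le_rfl, Matrix.mul_zero]
    rw [free_succ, crossMoment_add_self ((matCLM _).comp_memLp' hx) hw hcross,
      crossMoment_stateNoise_self_eq_stateNoiseCov hNoise, crossMoment_comp_self _ hx, ih, freeCov]

theorem crossMoment_free_sub_estimate_self (hInit : G.covInit.PosSemidef)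
    (hNoise : G.covNoise.PosSemidef) (n : ℕ) :
    crossMoment (G.law η) (⇑(G.free n) - G.estimate η n) (⇑(G.free n) - G.estimate η n) =
      G.freeCov n - G.estimateCov η n := by
  have hpythagoras := crossMoment_add_self (G.memLp_free_sub_estimate η n) (G.memLp_estimate η n)
    (crossMoment_free_sub_estimate (G.measurable_estimate η n) (G.memLp_estimate η n))
  rw [sub_add_cancel, crossMoment_free_self hInit hNoise] at hpythagoras
  exact eq_sub_of_add_eq hpythagoras.symm

theorem crossMoment_innovation_succ {e n : ℕ} {h : Sample κ m → Vec e}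
    (hh : Measurable[G.signalAlgebra η (n + 1)] h) (hh2 : MemLp h 2 (G.law η)) :
    crossMoment (G.law η) (G.innovation η (n + 1)) h = 0 := by
  have herr := G.memLp_free_sub_estimate η n
  have herr' := G.memLp_free_sub_estimate η (n + 1)
  have hw : MemLp (stateNoise n) 2 (G.law η) := memLp_two_clm _
  have hsplit : G.innovation η (n + 1) =
      (matCLM G.A ∘ (⇑(G.free n) - G.estimate η n) + ⇑(stateNoise n)) -
        (⇑(G.free (n + 1)) - G.estimate η (n + 1)) := by
    ext1 z
    simp only [innovation, free_succ, Pi.sub_apply, Pi.add_apply, Function.comp_apply, map_sub]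
    abel
  rw [hsplit, crossMoment_sub_left (((matCLM _).comp_memLp' herr).add hw) herr' hh2,
    crossMoment_add_left ((matCLM _).comp_memLp' herr) hw hh2, crossMoment_comp_left _ herr hh2,
    crossMoment_free_sub_estimate hh hh2, crossMoment_stateNoise_eq_zero hh,
    crossMoment_free_sub_estimate (hh.mono (G.signalAlgebra_mono η (n + 1).le_succ) le_rfl) hh2,
    Matrix.mul_zero, add_zero, sub_zero]

theorem crossMoment_innovation_self (n : ℕ) :
    crossMoment (G.law η) (G.innovation η n) (G.innovation η n) =
      G.estimateCov η n - G.priorCov (G.estimateCov η) n := by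
  cases n with
  | zero => exact (sub_zero _).symm
  | succ n =>
    have hest := G.memLp_estimate η n
    have hAest := (matCLM G.A).comp_memLp' hest
    have hpythagoras := crossMoment_add_self (G.memLp_innovation η (n + 1)) hAest
      (crossMoment_innovation_succ
        ((matCLM G.A).continuous.measurable.comp (G.measurable_estimate η n)) hAest)
    rw [crossMoment_comp_self _ hest, innovation, sub_add_cancel] at hpythagoras
    exact eq_sub_of_add_eq hpythagoras.symm

theorem crossMoment_filtered_self (n : ℕ) :
    crossMoment (G.law η) (G.filtered η ω n) (G.filtered η ω n) =
      G.predictedMoment ω (G.estimateCov η) n +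
        (G.estimateCov η n - G.priorCov (G.estimateCov η) n) := by
  induction n with
  | zero => exact (crossMoment_innovation_self 0).trans (zero_add _).symm
  | succ n ih =>
    have hfilt := G.memLp_filtered η ω n
    have hFfilt := (matCLM (G.A - G.B * G.stageGain ω n)).comp_memLp' hfilt
    have horth := crossMoment_eq_zero_comm.1 (crossMoment_innovation_succ
      ((matCLM (G.A - G.B * G.stageGain ω n)).continuous.measurable.comp
        (G.measurable_filtered η ω n)) hFfilt)
    rw [filtered, crossMoment_add_self hFfilt (G.memLp_innovation η (n + 1)) horth,
      crossMoment_comp_self _ hfilt, ih, crossMoment_innovation_self, predictedMoment]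

theorem crossMoment_path_optInput_self (hInit : G.covInit.PosSemidef)
    (hNoise : G.covNoise.PosSemidef) (n : ℕ) :
    crossMoment (G.law η) (G.path (G.optInput η ω) n) (G.path (G.optInput η ω) n) =
      G.pathMoment ω (G.estimateCov η) n := by
  rw [path_optInput, crossMoment_add_self (G.memLp_free_sub_estimate η n) (G.memLp_filtered η ω n)
      (crossMoment_free_sub_estimate (G.measurable_filtered η ω n) (G.memLp_filtered η ω n)),
    crossMoment_free_sub_estimate_self hInit hNoise, crossMoment_filtered_self, pathMoment]
  abel

theorem crossMoment_optInput_self (n : ℕ) :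
    crossMoment (G.law η) (G.optInput η ω n) (G.optInput η ω n) =
      G.inputMoment ω (G.estimateCov η) n := by
  rw [optInput, crossMoment_comp_self _ (G.memLp_filtered η ω n), crossMoment_filtered_self,
    inputMoment]
  simp only [Matrix.transpose_neg, Matrix.neg_mul, Matrix.mul_neg, neg_neg]

end Game

/-! ### Attainable covariances -/

section OrderInterval

variable {d : ℕ}

theorem isClosed_posSemidef : IsClosed {M : Matrix (Fin d) (Fin d) ℝ | M.PosSemidef} := by
  simp only [Matrix.posSemidef_iff_dotProduct_mulVec, Matrix.IsHermitian,
    Matrix.conjTranspose_eq_transpose_of_trivial, Set.ofPred_and, Set.ofPred_forall]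
  refine (isClosed_eq (by fun_prop) continuous_id).inter
    (isClosed_iInter fun x => isClosed_le continuous_const ?_)
  simp only [dotProduct, Matrix.mulVec]
  fun_prop

theorem abs_apply_le_of_posSemidef {M S : Matrix (Fin d) (Fin d) ℝ} (hM : M.PosSemidef)
    (hS : (S - M).PosSemidef) (i j : Fin d) : |M i j| ≤ S i i + S j j := by
  have hsymm : M j i = M i j := hM.isHermitian.apply i j
  have hadd := hM.dotProduct_mulVec_nonneg (Pi.single i 1 + Pi.single j 1)
  have hsub := hM.dotProduct_mulVec_nonneg (Pi.single i 1 - Pi.single j 1)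
  have hdiag (k : Fin d) : 0 ≤ S k k - M k k := hS.diag_nonneg
  have hi : 0 ≤ M i i := hM.diag_nonneg
  have hj : 0 ≤ M j j := hM.diag_nonneg
  simp only [star_trivial, Matrix.mulVec_add, Matrix.mulVec_sub, add_dotProduct, sub_dotProduct,
    dotProduct_add, dotProduct_sub, Matrix.mulVec_single_one, single_one_dotProduct,
    Matrix.col_apply, hsymm] at hadd hsub
  rw [abs_le]
  constructor <;> linarith [hdiag i, hdiag j]

theorem isCompact_setOf_posSemidef_sub (S : Matrix (Fin d) (Fin d) ℝ) :
    IsCompact {M : Matrix (Fin d) (Fin d) ℝ | M.PosSemidef ∧ (S - M).PosSemidef} := by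
  have hbox : IsCompact {M : Matrix (Fin d) (Fin d) ℝ |
      ∀ i j, M i j ∈ Set.Icc (-(S i i + S j j)) (S i i + S j j)} :=
    isCompact_pi_infinite fun i => isCompact_pi_infinite fun j => isCompact_Icc
  exact hbox.of_isClosed_subset
    (isClosed_posSemidef.inter (isClosed_posSemidef.preimage (continuous_const.sub continuous_id)))
    fun M hM i j => abs_le.1 (abs_apply_le_of_posSemidef hM.1 hM.2 i j)

end OrderInterval

namespace Game

variable (G : Game κ m r Ω)

/-- The sequences of covariances that the estimates of the control-free state can have: the
estimation error and the innovation have positive semidefinite covariances. -/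
def attainable : Set (ℕ → Matrix (Fin m) (Fin m) ℝ) :=
  {H | ∀ n, (H n).PosSemidef ∧ (G.freeCov n - H n).PosSemidef ∧
    (H n - G.priorCov H n).PosSemidef}

theorem isCompact_attainable : IsCompact G.attainable := by
  refine (isCompact_pi_infinite fun n => isCompact_setOf_posSemidef_sub
    (G.freeCov n)).of_isClosed_subset ?_ fun H hH n => ⟨(hH n).1, (hH n).2.1⟩
  simp only [attainable, Set.ofPred_forall, Set.ofPred_and]
  refine isClosed_iInter fun n => ?_
  have happly : Continuous fun H : ℕ → Matrix (Fin m) (Fin m) ℝ => H n := continuous_apply n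
  exact (isClosed_posSemidef.preimage happly).inter
    ((isClosed_posSemidef.preimage (continuous_const.sub happly)).inter
      (isClosed_posSemidef.preimage (happly.sub (G.continuous_priorCov n))))

variable {G}

theorem estimateCov_mem_attainable (hInit : G.covInit.PosSemidef) (hNoise : G.covNoise.PosSemidef)
    (η : SignalingRule κ m) : G.estimateCov η ∈ G.attainable := by
  refine fun n => ⟨posSemidef_crossMoment_self (G.memLp_estimate η n), ?_, ?_⟩
  · rw [← crossMoment_free_sub_estimate_self hInit hNoise]
    exact posSemidef_crossMoment_self (G.memLp_free_sub_estimate η n)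
  · rw [← crossMoment_innovation_self]
    exact posSemidef_crossMoment_self (G.memLp_innovation η n)

end Game

/-! ### Factoring a positive semidefinite matrix through a larger one -/

section Factorization

variable {d : ℕ} {M D L : Matrix (Fin d) (Fin d) ℝ}

theorem mulVec_eq_zero_of_posSemidef_sub (hD : D.PosSemidef) (hMD : (M - D).PosSemidef)
    {v : Fin d → ℝ} (hv : M *ᵥ v = 0) : D *ᵥ v = 0 := by
  have hsub := hMD.dotProduct_mulVec_nonneg v
  rw [Matrix.sub_mulVec, hv, zero_sub, dotProduct_neg, neg_nonneg] at hsub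
  exact (hD.dotProduct_mulVec_zero_iff v).1 (hsub.antisymm (hD.dotProduct_mulVec_nonneg v))

theorem exists_mul_eq_of_mulVec_eq_zero (hM : M.IsHermitian) (hD : D.IsHermitian)
    (hker : ∀ v, M *ᵥ v = 0 → D *ᵥ v = 0) : ∃ L, M * L = D := by
  have hcol (j : Fin d) : ∃ y : Vec d, Matrix.toEuclideanLin M y = WithLp.toLp 2 (D.col j) := by
    rw [← LinearMap.mem_range, ← Submodule.orthogonal_orthogonal (LinearMap.range _),
      (Matrix.isSymmetric_toEuclideanLin_iff.2 hM).orthogonal_range, Submodule.mem_orthogonal]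
    intro v hv
    have hDv : (Dᵀ *ᵥ v.ofLp) j = 0 := by
      rw [← Matrix.conjTranspose_eq_transpose_of_trivial, hD.eq,
        hker v.ofLp (congrArg WithLp.ofLp (LinearMap.mem_ker.1 hv)), Pi.zero_apply]
    simpa [PiLp.inner_apply, Matrix.mulVec, dotProduct] using hDv
  choose y hy using hcol
  refine ⟨Matrix.of fun i j => y j i, ?_⟩
  ext i j
  exact congrFun (congrArg WithLp.ofLp (hy j)) i

theorem exists_mul_eq_of_posSemidef_sub (hD : D.PosSemidef) (hMD : (M - D).PosSemidef) :
    ∃ L, M * L = D :=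
  exists_mul_eq_of_mulVec_eq_zero (by simpa using (hD.add hMD).isHermitian) hD.isHermitian
    fun _ => mulVec_eq_zero_of_posSemidef_sub hD hMD

theorem posSemidef_sub_transpose_mul_mul (hD : D.PosSemidef) (hMD : (M - D).PosSemidef)
    (hL : M * L = D) : (D - Lᵀ * M * L).PosSemidef := by
  have hDt : Dᵀ = D := hD.isHermitian
  have hMt : Mᵀ = M := by
    rw [← sub_add_cancel M D, Matrix.transpose_add, hDt]
    exact congrArg (· + D) hMD.isHermitian
  have hLt : Lᵀ * M = D := by rw [← hDt, ← hL, Matrix.transpose_mul, hMt]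
  have hcomm : D * L = Lᵀ * D := by rw [← hLt, Matrix.mul_assoc, hL, hLt]
  have hsum : D - Lᵀ * M * L = Lᵀ * (M - D) * L + (1 - L)ᵀ * D * (1 - L) := by
    simp only [Matrix.transpose_sub, Matrix.transpose_one, Matrix.mul_sub, Matrix.sub_mul, hLt,
      hcomm, Matrix.mul_one, Matrix.one_mul]
    abel
  rw [hsum]
  simpa only [Matrix.conjTranspose_eq_transpose_of_trivial] using
    (hMD.conjTranspose_mul_mul_same L).add (hD.conjTranspose_mul_mul_same (1 - L))

end Factorization

/-! ### Realization of attainable covariances -/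

section Measurement

variable {S : Type*} [MeasurableSpace S] {μ : Measure S} {d : ℕ} {D L : Matrix (Fin d) (Fin d) ℝ}
  {e θ : S → Vec d}

theorem crossMoment_measurement (he : MemLp e 2 μ) (hθ : MemLp θ 2 μ)
    (horth : crossMoment μ e θ = 0) :
    crossMoment μ e (matCLM Lᵀ ∘ e + θ) = crossMoment μ e e * L := by
  rw [crossMoment_add_right he ((matCLM _).comp_memLp' he) hθ, crossMoment_comp_right _ he he,
    horth, add_zero, Matrix.transpose_transpose]

theorem crossMoment_measurement_self (he : MemLp e 2 μ) (hθ : MemLp θ 2 μ)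
    (horth : crossMoment μ e θ = 0) :
    crossMoment μ (matCLM Lᵀ ∘ e + θ) (matCLM Lᵀ ∘ e + θ) =
      Lᵀ * crossMoment μ e e * L + crossMoment μ θ θ := by
  have hcross : crossMoment μ (matCLM Lᵀ ∘ e) θ = 0 := by
    rw [crossMoment_comp_left _ he hθ, horth, Matrix.mul_zero]
  rw [crossMoment_add_self ((matCLM _).comp_memLp' he) hθ hcross, crossMoment_comp_self _ he,
    Matrix.transpose_transpose]

theorem crossMoment_sub_measurement (he : MemLp e 2 μ) (hθ : MemLp θ 2 μ)
    (horth : crossMoment μ e θ = 0) (hL : crossMoment μ e e * L = D)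
    (hcov : crossMoment μ θ θ = D - Lᵀ * crossMoment μ e e * L) :
    crossMoment μ (e - (matCLM Lᵀ ∘ e + θ)) (matCLM Lᵀ ∘ e + θ) = 0 := by
  have hν := ((matCLM Lᵀ).comp_memLp' he).add hθ
  rw [crossMoment_sub_left he hν hν, crossMoment_measurement he hθ horth,
    crossMoment_measurement_self he hθ horth, hL, hcov, add_sub_cancel, sub_self]

theorem crossMoment_sub_measurement_self (he : MemLp e 2 μ) (hθ : MemLp θ 2 μ)
    (horth : crossMoment μ e θ = 0) (hL : crossMoment μ e e * L = D)
    (hcov : crossMoment μ θ θ = D - Lᵀ * crossMoment μ e e * L) :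
    crossMoment μ (e - (matCLM Lᵀ ∘ e + θ)) (e - (matCLM Lᵀ ∘ e + θ)) =
      crossMoment μ e e - D := by
  have hν := ((matCLM Lᵀ).comp_memLp' he).add hθ
  have hpythagoras := crossMoment_add_self (he.sub hν) hν
    (crossMoment_sub_measurement he hθ horth hL hcov)
  rw [sub_add_cancel, crossMoment_measurement_self he hθ horth, hcov, add_sub_cancel]
    at hpythagoras
  exact eq_sub_of_add_eq hpythagoras.symm

end Measurement

/-- The signaling rule that sends `(L k)' * x k + θ k` with `θ k ∼ N(0, Θ k)`. -/
def memoryless (L Θ : Fin κ → Matrix (Fin m) (Fin m) ℝ) (hΘ : ∀ k, (Θ k).PosSemidef) :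
    SignalingRule κ m where
  gain k i := if i.val = k.val then L k else 0
  noiseCov := Θ
  noiseCov_posSemidef := hΘ

namespace Game

/-- `f` is a linear estimate of the control-free state `n` from the first `N` signals whose error
is orthogonal to these signals and has covariance `C`. -/
structure IsLinearEstimate (G : Game κ m r Ω) (η : SignalingRule κ m) (n N : ℕ)
    (C : Matrix (Fin m) (Fin m) ℝ) (f : Sample κ m →L[ℝ] Vec m) : Prop where
  measurable : Measurable[G.signalAlgebra η N] f
  orthogonal : ∀ k : Fin κ, k.val < N →
    crossMoment (G.law η) (G.free n - f : Sample κ m →L[ℝ] Vec m) (G.freeSignal η k) = 0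
  errorCov : crossMoment (G.law η) (G.free n - f : Sample κ m →L[ℝ] Vec m)
    (G.free n - f : Sample κ m →L[ℝ] Vec m) = C

variable {G : Game κ m r Ω} {η : SignalingRule κ m} {n : ℕ} {C D L : Matrix (Fin m) (Fin m) ℝ}
  {f : Sample κ m →L[ℝ] Vec m}

theorem freeSignal_memoryless (L Θ : Fin κ → Matrix (Fin m) (Fin m) ℝ)
    (hΘ : ∀ k, (Θ k).PosSemidef) (k : Fin κ) :
    G.freeSignal (memoryless L Θ hΘ) k = matCLM (L k)ᵀ ∘L G.free k + signalNoise k := by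
  rw [freeSignal, Fin.sum_univ_castSucc]
  have hpast (i : Fin k.val) : (memoryless L Θ hΘ).gain k i.castSucc = 0 := if_neg i.isLt.ne
  have hlast : (memoryless L Θ hΘ).gain k (Fin.last k.val) = L k := if_pos rfl
  simp [hpast, hlast]

theorem crossMoment_signalNoise_eq_zero {e : ℕ} {k : Fin κ} {h : Sample κ m → Vec e}
    (hh : Measurable[G.signalAlgebra η k] h) :
    crossMoment (G.law η) (signalNoise k) h = 0 :=
  crossMoment_eq_zero_of_freeSignal (fun _ hl => crossMoment_freeSignal_eq_zero
    (fun i _ => crossMoment_eq_zero_comm.1 (crossMoment_free_signalNoise i k))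
    (crossMoment_signalNoise_of_ne (Fin.ne_of_gt hl))) hh

theorem isLinearEstimate_zero (hInit : G.covInit.PosSemidef) :
    G.IsLinearEstimate η 0 0 G.covInit 0 where
  measurable := measurable_const
  orthogonal _ hk := absurd hk (Nat.not_lt_zero _)
  errorCov := by rw [sub_zero, crossMoment_free_zero_self hInit]

namespace IsLinearEstimate

theorem crossMoment_sub_signalNoise {k : Fin κ} (hf : G.IsLinearEstimate η n k C f) :
    crossMoment (G.law η) (G.free n - f : Sample κ m →L[ℝ] Vec m) (signalNoise k) = 0 := by
  refine (crossMoment_sub_left (memLp_two_clm _) (memLp_two_clm _) (memLp_two_clm _)).trans ?_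
  rw [crossMoment_free_signalNoise,
    crossMoment_eq_zero_comm.1 (crossMoment_signalNoise_eq_zero hf.measurable), sub_zero]

theorem crossMoment_sub_stateNoise (hf : G.IsLinearEstimate η n (n + 1) C f) :
    crossMoment (G.law η) (G.free n - f : Sample κ m →L[ℝ] Vec m) (stateNoise n) = 0 := by
  refine (crossMoment_sub_left (memLp_two_clm _) (memLp_two_clm _) (memLp_two_clm _)).trans ?_
  rw [crossMoment_free_stateNoise le_rfl,
    crossMoment_eq_zero_comm.1 (crossMoment_stateNoise_eq_zero hf.measurable), sub_zero]

theorem predict (hNoise : G.covNoise.PosSemidef) (hf : G.IsLinearEstimate η n (n + 1) C f) :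
    G.IsLinearEstimate η (n + 1) (n + 1) (G.A * C * G.Aᵀ + G.stateNoiseCov n)
      (matCLM G.A ∘L f) := by
  let e : Sample κ m →L[ℝ] Vec m := G.free n - f
  have he : MemLp e 2 (G.law η) := memLp_two_clm _
  have hAe : MemLp (matCLM G.A ∘ e) 2 (G.law η) := (matCLM _).comp_memLp' he
  have hw : MemLp (stateNoise n) 2 (G.law η) := memLp_two_clm _
  have herror : ⇑(G.free (n + 1) - matCLM G.A ∘L f : Sample κ m →L[ℝ] Vec m) =
      matCLM G.A ∘ e + ⇑(stateNoise n) := by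
    ext1 z
    simp only [e, free, _root_.sub_apply, _root_.add_apply, ContinuousLinearMap.comp_apply,
      Pi.add_apply, Function.comp_apply, map_sub]
    abel
  refine ⟨(matCLM G.A).continuous.measurable.comp hf.measurable, fun k hk => ?_, ?_⟩
  · rw [herror, crossMoment_add_left hAe hw (memLp_two_clm _),
      crossMoment_comp_left _ he (memLp_two_clm _), hf.orthogonal k hk,
      crossMoment_stateNoise_eq_zero (G.measurable_freeSignal η hk), Matrix.mul_zero, add_zero]
  · have hAcross : crossMoment (G.law η) (matCLM G.A ∘ e) (stateNoise n) = 0 := by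
      rw [crossMoment_comp_left _ he hw, hf.crossMoment_sub_stateNoise, Matrix.mul_zero]
    rw [herror, crossMoment_add_self hAe hw hAcross, crossMoment_comp_self _ he, hf.errorCov,
      crossMoment_stateNoise_self_eq_stateNoiseCov hNoise]

theorem crossMoment_measurement_freeSignal {k l : Fin κ} (hf : G.IsLinearEstimate η k k C f)
    (hl : l.val < k.val) :
    crossMoment (G.law η) (matCLM Lᵀ ∘ (G.free k - f : Sample κ m →L[ℝ] Vec m) + ⇑(signalNoise k))
      (G.freeSignal η l) = 0 := by
  rw [crossMoment_add_left ((matCLM _).comp_memLp' (memLp_two_clm _)) (memLp_two_clm _)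
      (memLp_two_clm _), crossMoment_comp_left _ (memLp_two_clm _) (memLp_two_clm _),
    hf.orthogonal l hl, crossMoment_signalNoise_eq_zero (G.measurable_freeSignal η hl),
    Matrix.mul_zero, add_zero]

theorem update {k : Fin κ} (hf : G.IsLinearEstimate η k k C f)
    (hsignal : G.freeSignal η k = matCLM Lᵀ ∘L G.free k + signalNoise k) (hL : C * L = D)
    (hcov : η.noiseCov k = D - Lᵀ * C * L) :
    G.IsLinearEstimate η k (k + 1) (C - D) (f + (G.freeSignal η k - matCLM Lᵀ ∘L f)) := by
  let e : Sample κ m →L[ℝ] Vec m := G.free k - f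
  let ν : Sample κ m →L[ℝ] Vec m := matCLM Lᵀ ∘L e + signalNoise k
  have he : MemLp e 2 (G.law η) := memLp_two_clm _
  have hθ : MemLp (signalNoise k) 2 (G.law η) := memLp_two_clm _
  have hCe : crossMoment (G.law η) e e * L = D := hf.errorCov ▸ hL
  have hθcov : crossMoment (G.law η) (signalNoise k) (signalNoise k) =
      D - Lᵀ * crossMoment (G.law η) e e * L := by
    rw [hf.errorCov, crossMoment_signalNoise_self, hcov]
  have horth := hf.crossMoment_sub_signalNoise
  have hν : G.freeSignal η k = ν + matCLM Lᵀ ∘L f := by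
    rw [hsignal]
    simp only [ν, e, ContinuousLinearMap.comp_sub]
    abel
  have herror : G.free k - (f + (G.freeSignal η k - matCLM Lᵀ ∘L f)) = e - ν := by
    rw [hν, add_sub_cancel_right, sub_add_eq_sub_sub]
  have hpast (l : Fin κ) (hl : l.val < k.val) :
      crossMoment (G.law η) (e - ν : Sample κ m →L[ℝ] Vec m) (G.freeSignal η l) = 0 := by
    refine (crossMoment_sub_left he (memLp_two_clm ν) (memLp_two_clm _)).trans ?_
    rw [hf.orthogonal l hl, zero_sub, neg_eq_zero]
    exact hf.crossMoment_measurement_freeSignal hl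
  refine ⟨?_, fun l hl => ?_, ?_⟩
  · have hfk := hf.measurable.mono (G.signalAlgebra_mono η k.val.le_succ) le_rfl
    exact hfk.add ((G.measurable_freeSignal η k.val.lt_succ_self).sub
      ((matCLM _).continuous.measurable.comp hfk))
  · rw [herror]
    rcases (Nat.lt_succ_iff.1 hl).lt_or_eq with hlt | heq
    · exact hpast l hlt
    rw [Fin.ext heq, hν]
    refine (crossMoment_add_right (memLp_two_clm _) (memLp_two_clm ν) (memLp_two_clm _)).trans ?_
    refine (congrArg₂ (· + ·) (crossMoment_sub_measurement he hθ horth hCe hθcov)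
      (crossMoment_eq_zero_of_freeSignal hpast ?_)).trans (add_zero 0)
    exact (matCLM Lᵀ).continuous.measurable.comp hf.measurable
  · rw [herror, ← hf.errorCov]
    exact crossMoment_sub_measurement_self he hθ horth hCe hθcov

theorem estimateCov_eq (hInit : G.covInit.PosSemidef) (hNoise : G.covNoise.PosSemidef)
    (hf : G.IsLinearEstimate η n (n + 1) C f) : G.estimateCov η n = G.freeCov n - C := by
  let e : Sample κ m →L[ℝ] Vec m := G.free n - f
  let δ : Sample κ m → Vec m := G.estimate η n - ⇑f
  have he : MemLp e 2 (G.law η) := memLp_two_clm _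
  have hδ : MemLp δ 2 (G.law η) := (G.memLp_estimate η n).sub (memLp_two_clm _)
  have hδm : Measurable[G.signalAlgebra η (n + 1)] δ :=
    (G.measurable_estimate η n).sub hf.measurable
  have hsplit : ⇑(G.free n) - G.estimate η n = ⇑e - δ := (sub_sub_sub_cancel_right _ _ _).symm
  have heδ : crossMoment (G.law η) e δ = 0 := crossMoment_eq_zero_of_freeSignal hf.orthogonal hδm
  have hδδ : crossMoment (G.law η) δ δ = 0 := by
    have := crossMoment_free_sub_estimate hδm hδ
    rwa [hsplit, crossMoment_sub_left he hδ hδ, heδ, zero_sub, neg_eq_zero] at this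
  have hcov := crossMoment_free_sub_estimate_self (η := η) hInit hNoise n
  rw [hsplit, crossMoment_sub_left he hδ (he.sub hδ), crossMoment_sub_right he he hδ,
    crossMoment_sub_right hδ he hδ, heδ, crossMoment_eq_zero_comm.1 heδ, hδδ, hf.errorCov,
    sub_zero, sub_zero, sub_zero] at hcov
  rw [hcov, sub_sub_cancel]

end IsLinearEstimate

theorem exists_isLinearEstimate_prior (hInit : G.covInit.PosSemidef)
    (hNoise : G.covNoise.PosSemidef) {H : ℕ → Matrix (Fin m) (Fin m) ℝ}
    {L : Fin κ → Matrix (Fin m) (Fin m) ℝ}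
    (hsignal : ∀ k, G.freeSignal η k = matCLM (L k)ᵀ ∘L G.free k + signalNoise k)
    (hL : ∀ k : Fin κ, (G.freeCov k - G.priorCov H k) * L k = H k - G.priorCov H k)
    (hcov : ∀ k : Fin κ, η.noiseCov k =
      H k - G.priorCov H k - (L k)ᵀ * (G.freeCov k - G.priorCov H k) * L k)
    {n : ℕ} (hn : n ≤ κ) :
    ∃ f, G.IsLinearEstimate η n n (G.freeCov n - G.priorCov H n) f := by
  induction n with
  | zero =>
    refine ⟨0, ?_⟩
    rw [priorCov, freeCov, sub_zero]
    exact isLinearEstimate_zero hInit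
  | succ n ih =>
    obtain ⟨f, hf⟩ := ih (n.le_succ.trans hn)
    lift n to Fin κ using hn
    refine ⟨_, (?_ : G.A * _ * G.Aᵀ + _ = _) ▸
      (hf.update (hsignal n) (hL n) (hcov n)).predict hNoise⟩
    rw [freeCov, priorCov, sub_sub_sub_cancel_right, Matrix.mul_sub, Matrix.sub_mul]
    abel

theorem exists_signalingRule (hInit : G.covInit.PosSemidef) (hNoise : G.covNoise.PosSemidef)
    {H : ℕ → Matrix (Fin m) (Fin m) ℝ} (hH : H ∈ G.attainable) :
    ∃ η : SignalingRule κ m, ∀ n < κ, G.estimateCov η n = H n := by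
  have hdom (n : ℕ) : (G.freeCov n - G.priorCov H n - (H n - G.priorCov H n)).PosSemidef := by
    rw [sub_sub_sub_cancel_right]
    exact (hH n).2.1
  choose L hL using fun n => exists_mul_eq_of_posSemidef_sub (hH n).2.2 (hdom n)
  let η := memoryless (κ := κ) (fun k => L k) _ fun k =>
    posSemidef_sub_transpose_mul_mul (hH k).2.2 (hdom k) (hL k)
  have hsignal (k : Fin κ) :
      G.freeSignal η k = matCLM (L k)ᵀ ∘L G.free k + signalNoise k := freeSignal_memoryless _ _ _ k
  refine ⟨η, fun n hn => ?_⟩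
  obtain ⟨f, hf⟩ := exists_isLinearEstimate_prior hInit hNoise hsignal (fun k => hL k)
    (fun _ => rfl) hn.le
  lift n to Fin κ using hn
  rw [(hf.update (hsignal n) (hL n) rfl).estimateCov_eq hInit hNoise, sub_sub_sub_cancel_right,
    sub_sub_cancel]

end Game

/-! ### The objective of the leader -/

namespace Game

section LeaderCost

variable (G : Game κ m r Ω)

/-- The leader's state cost when the type-`ω` follower best responds, as a function of the
covariances `H` of the estimates of the control-free state. -/
def stateCostOf (ω : Option Ω) (H : ℕ → Matrix (Fin m) (Fin m) ℝ) : ℝ≥0∞ :=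
  ∑ n ∈ Finset.range κ, ENNReal.ofReal (G.Q none * G.pathMoment ω H (n + 1)).trace

/-- The leader's control cost when the controller best responds, as a function of the
covariances `H` of the estimates of the control-free state. -/
def controlCostOf (H : ℕ → Matrix (Fin m) (Fin m) ℝ) : ℝ≥0∞ :=
  ∑ n ∈ Finset.range κ, ENNReal.ofReal (G.R none * G.inputMoment none H n).trace

/-- The leader's objective under best responses, as a function of the covariances `H` of the
estimates of the control-free state. -/
def leaderCostOf [Fintype Ω] (H : ℕ → Matrix (Fin m) (Fin m) ℝ) : ℝ≥0∞ :=
  ⨆ p ∈ stdSimplex ℝ (Option Ω),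
    (∑ ω : Ω, ENNReal.ofReal (p (some ω)) * G.stateCostOf (some ω) H)
      + ENNReal.ofReal (p none) * (G.stateCostOf none H + G.controlCostOf H)

theorem continuous_stateCostOf (ω : Option Ω) : Continuous (G.stateCostOf ω) :=
  continuous_finsetSum _ fun n _ => ENNReal.continuous_ofReal.comp
    (continuous_const.matrix_mul (G.continuous_pathMoment ω (n + 1))).matrix_trace

theorem continuous_controlCostOf : Continuous G.controlCostOf :=
  continuous_finsetSum _ fun n _ => ENNReal.continuous_ofReal.comp
    (continuous_const.matrix_mul (G.continuous_inputMoment none n)).matrix_trace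

theorem lowerSemicontinuous_leaderCostOf [Fintype Ω] : LowerSemicontinuous G.leaderCostOf :=
  lowerSemicontinuous_biSup fun _ _ => Continuous.lowerSemicontinuous <|
    (continuous_finsetSum _ fun _ _ =>
      (ENNReal.continuous_const_mul ENNReal.ofReal_ne_top).comp (G.continuous_stateCostOf _)).add
    ((ENNReal.continuous_const_mul ENNReal.ofReal_ne_top).comp
      ((G.continuous_stateCostOf _).add G.continuous_controlCostOf))

variable {H H' : ℕ → Matrix (Fin m) (Fin m) ℝ}

theorem stateCostOf_congr (ω : Option Ω) (h : ∀ n < κ, H n = H' n) :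
    G.stateCostOf ω H = G.stateCostOf ω H' :=
  Finset.sum_congr rfl fun _ hn => by
    rw [G.pathMoment_congr ω fun i hi =>
      h i ((Nat.lt_succ_iff.1 hi).trans_lt (Finset.mem_range.1 hn))]

theorem controlCostOf_congr (h : ∀ n < κ, H n = H' n) : G.controlCostOf H = G.controlCostOf H' :=
  Finset.sum_congr rfl fun _ hn => by
    rw [G.inputMoment_congr none fun i hi => h i (hi.trans_lt (Finset.mem_range.1 hn))]

theorem leaderCostOf_congr [Fintype Ω] (h : ∀ n < κ, H n = H' n) :
    G.leaderCostOf H = G.leaderCostOf H' := by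
  simp only [leaderCostOf, G.stateCostOf_congr _ h, G.controlCostOf_congr h]

end LeaderCost

variable {G : Game κ m r Ω} {η : SignalingRule κ m}

theorem IsBestResponse.stateCost_eq_stateCostOf {ω : Option Ω} {γ : ControlPolicy κ m r}
    (hγ : G.IsBestResponse ω η γ) (hInit : G.covInit.PosSemidef) (hNoise : G.covNoise.PosSemidef)
    (hQ : ∀ ω, (G.Q ω).PosSemidef) (hR : (G.R ω).PosDef) :
    G.stateCost (G.Q none) η γ = G.stateCostOf ω (G.estimateCov η) := by
  rw [hγ.stateCost_eq (hQ ω) hR (hQ none), stateCostOf]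
  refine Finset.sum_congr rfl fun n _ => ?_
  rw [integral_wsq _ ((G.isAdmissible_optInput η ω).memLp_path _),
    crossMoment_path_optInput_self hInit hNoise]

theorem IsBestResponse.controlCost_eq_controlCostOf {γ : ControlPolicy κ m r}
    (hγ : G.IsBestResponse none η γ) (hQ : (G.Q none).PosSemidef) (hR : (G.R none).PosDef) :
    G.controlCost (G.R none) η γ = G.controlCostOf (G.estimateCov η) := by
  rw [hγ.controlCost_eq hQ hR hR.posSemidef, controlCostOf]
  refine Finset.sum_congr rfl fun n _ => ?_
  rw [integral_wsq _ ((G.isAdmissible_optInput η none).memLp n), crossMoment_optInput_self]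

theorem leaderCost_eq_leaderCostOf [Fintype Ω] (hInit : G.covInit.PosSemidef)
    (hNoise : G.covNoise.PosSemidef) (hQ : ∀ ω, (G.Q ω).PosSemidef) (hR : ∀ ω, (G.R ω).PosDef)
    {γ : Option Ω → ControlPolicy κ m r} (hγ : ∀ ω, G.IsBestResponse ω η (γ ω)) :
    G.leaderCost η γ = G.leaderCostOf (G.estimateCov η) := by
  have hstate (ω : Option Ω) := (hγ ω).stateCost_eq_stateCostOf hInit hNoise hQ (hR ω)
  have hcontrol := (hγ none).controlCost_eq_controlCostOf (hQ none) (hR none)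
  simp only [leaderCost, leaderCostOf, hstate, hcontrol]

theorem attainable_nonempty (hInit : G.covInit.PosSemidef) (hNoise : G.covNoise.PosSemidef) :
    G.attainable.Nonempty :=
  ⟨_, estimateCov_mem_attainable hInit hNoise
    { gain := 0, noiseCov := 0, noiseCov_posSemidef := fun _ => .zero }⟩

theorem exists_isMinOn_leaderCostOf [Fintype Ω] (hInit : G.covInit.PosSemidef)
    (hNoise : G.covNoise.PosSemidef) :
    ∃ η : SignalingRule κ m, IsMinOn G.leaderCostOf G.attainable (G.estimateCov η) := by
  obtain ⟨H, hH, hmin⟩ := (G.lowerSemicontinuous_leaderCostOf.lowerSemicontinuousOn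
    G.attainable).exists_isMinOn (attainable_nonempty hInit hNoise) G.isCompact_attainable
  obtain ⟨η, hη⟩ := exists_signalingRule hInit hNoise hH
  exact ⟨η, fun H' hH' => (G.leaderCostOf_congr hη).trans_le (hmin hH')⟩

end Game

end SensorDesign

end

open SensorDesign SensorDesign.Game in
theorem proposition2 {Ω : Type*} [Fintype Ω] {κ m r : ℕ} (G : SensorDesign.Game κ m r Ω)
    (hInit : G.covInit.PosSemidef) (hNoise : G.covNoise.PosSemidef)
    (hQ : ∀ ω, (G.Q ω).PosSemidef) (hR : ∀ ω, (G.R ω).PosDef) :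
    (∀ (η : SensorDesign.SignalingRule κ m) (γ γ' : Option Ω → SensorDesign.ControlPolicy κ m r),
        (∀ ω, G.IsBestResponse ω η (γ ω)) → (∀ ω, G.IsBestResponse ω η (γ' ω)) →
          G.leaderCost η γ = G.leaderCost η γ') ∧
      ∃ (η : SensorDesign.SignalingRule κ m)
        (γ : Option Ω → SensorDesign.SignalingRule κ m → SensorDesign.ControlPolicy κ m r),
        G.IsStackelbergEquilibrium η γ := by
  have hcost {η : SignalingRule κ m} {γ : Option Ω → ControlPolicy κ m r}
      (hγ : ∀ ω, G.IsBestResponse ω η (γ ω)) :=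
    leaderCost_eq_leaderCostOf hInit hNoise hQ hR hγ
  refine ⟨fun η γ γ' hγ hγ' => (hcost hγ).trans (hcost hγ').symm, ?_⟩
  obtain ⟨η, hmin⟩ := exists_isMinOn_leaderCostOf hInit hNoise
  choose γ hγ using fun ω (η : SignalingRule κ m) =>
    exists_isBestResponse (η := η) (hQ ω) (hR ω)
  refine ⟨η, γ, hγ, fun η' => ?_⟩
  rw [hcost fun ω => hγ ω η, hcost fun ω => hγ ω η']
  exact hmin (estimateCov_mem_attainable hInit hNoise η')
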